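/- **Setting.** A *metric $f$-manifold* is a smooth manifold $\bar M$ of dimension $2n+s$ with a $(1,1)$-tensor field $\varphi$, vector fields $\xi_1,\dots,\xi_s$, $1$-forms $\eta^1,\dots,\eta^s$ and a Riemannian metric $g$ (all smooth) such that, for all $X,Y\in\Gamma(T\bar M)$ and all $i,j$, $$\varphi^2=-I+\sum_{i=1}^s\eta^i\otimes\xi_i,\quad \eta^i(\xi_j)=\delta_{ij},\quad \varphi\xi_i=0,\quad g(\varphi X,\varphi Y)=g(X,Y)-\sum_{i=1}^s\eta^i(X)\eta^i(Y)$$ (then also $\eta^i\circ\varphi=0$, $\eta^i(X)=g(X,\xi_i)$ and $g(X,\varphi Y)=-g(\varphi X,Y)$). Put $\Phi(X,Y)=g(X,\varphi Y)$. It is a *generalized Kenmotsu manifold* if $s\ge1$, $\eta^1\wedge\dots\wedge\eta^s\wedge\Phi^n\ne0$ everywhere, $d\eta^i=0$ for all $i$, $d\Phi=2\sum_{i=1}^s\eta^i\wedge\Phi$, and it is normal, i.e. $[\varphi,\varphi]+2\sum_{i=1}^s d\eta^i\otimes\xi_i=0$, where $[\varphi,\varphi]$ is the Nijenhuis tensor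 of $\varphi$. A submanifold $M$ of $\bar M$, with the induced metric (again written $g$), is *invariant* if $\varphi(T_xM)\subset T_xM$ for all $x\in M$ and all $\xi_i$ are tangent to $M$. Let $\nabla$ be the Levi-Civita connection of $M$ and $R(X,Y)=\nabla_X\nabla_Y-\nabla_Y\nabla_X-\nabla_{[X,Y]}$ its curvature. **Theorem.** Let $M$ be an (immersed) invariant submanifold of a $(2n+s)$-dimensional generalized Kenmotsu manifold $\bar M$. Then for all $X,Y\in\Gamma(TM)$ and all $i,j,k\in\{1,\dots,s\}$, $$R(X,Y)\xi_i=\sum_{l=1}^s\{\eta^l(Y)\varphi^2X-\eta^l(X)\varphi^2Y\},$$ $$R(\xi_j,X)\xi_i=-\varphi^2X,\qquad R(X,\xi_j)\xi_i=\varphi^2X,\qquad R(\xi_k,\xi_j)\xi_i=0,$$ $$R(\xi_j,X)Y=\sum_{l=1}^s\{g(X,\varphi^2Y)\xi_l-\eta^l(Y)\varphi^2X\}.$$ -/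

import Mathlib

open Bundle VectorField
open scoped Manifold ContDiff InnerProductSpace

noncomputable section

/-- The tangent bundle of a manifold without boundary modelled on the finite-dimensional real
vector space `E`, as a family of vector spaces. -/
abbrev TanBundle (E : Type*) [NormedAddCommGroup E] [NormedSpace ℝ E]
    (M : Type*) [TopologicalSpace M] [ChartedSpace E M] :
    M → Type _ :=
  fun x : M => TangentSpace 𝓘(ℝ, E) x

/-- A (not necessarily continuous) vector field on `M`. -/
abbrev VField (E : Type*) [NormedAddCommGroup E] [NormedSpace ℝ E]
    (M : Type*) [TopologicalSpace M] [ChartedSpace E M] : Type _ :=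
  ∀ x : M, TangentSpace 𝓘(ℝ, E) x

/-- The vector field `X` is smooth on `M`, that is, `X ∈ Γ(TM)`. -/
def SmoothField {E : Type*} [NormedAddCommGroup E] [NormedSpace ℝ E]
    {M : Type*} [TopologicalSpace M] [ChartedSpace E M]
    [IsManifold 𝓘(ℝ, E) ∞ M] (X : VField E M) : Prop :=
  ContMDiff 𝓘(ℝ, E) 𝓘(ℝ, E).tangent ∞ (fun x => (⟨x, X x⟩ : TangentBundle 𝓘(ℝ, E) M))

/-- The vector field `X` is differentiable at the point `x`. -/
def DiffFieldAt {E : Type*} [NormedAddCommGroup E] [NormedSpace ℝ E]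
    {M : Type*} [TopologicalSpace M] [ChartedSpace E M]
    [IsManifold 𝓘(ℝ, E) ∞ M] (X : VField E M) (x : M) : Prop :=
  MDifferentiableAt 𝓘(ℝ, E) 𝓘(ℝ, E).tangent (fun y => (⟨y, X y⟩ : TangentBundle 𝓘(ℝ, E) M)) x

/-- The derivative of the function `u` at `x` in the direction of the tangent vector `v`. -/
def dirDeriv {E : Type*} [NormedAddCommGroup E] [NormedSpace ℝ E]
    {M : Type*} [TopologicalSpace M] [ChartedSpace E M]
    (u : M → ℝ) (x : M) (v : TangentSpace 𝓘(ℝ, E) x) : ℝ :=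
  (mfderiv 𝓘(ℝ, E) 𝓘(ℝ, ℝ) u x : TangentSpace 𝓘(ℝ, E) x →L[ℝ] ℝ) v

/-! ### Metric `f`-structures -/

/-- A metric `f`-structure `(φ, ξ_i, η^i, g)` on a manifold `M` of dimension `2n + s`; the
Riemannian metric `g` is the one carried by the `RiemannianBundle` instance.

The field `phi_xi` says, given the other ones, that `φ ^ 3 + φ = 0`. The identities
`η^i ∘ φ = 0`, `η^i(X) = g(X, ξ_i)` and `g(X, φ Y) = - g(φ X, Y)` then follow. -/
structure MetricFStructure (E : Type*) [NormedAddCommGroup E] [NormedSpace ℝ E] (n s : ℕ)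
    (M : Type*) [TopologicalSpace M]
    [ChartedSpace E M] [IsManifold 𝓘(ℝ, E) ∞ M]
    [RiemannianBundle (TanBundle E M)] where
  finrank_eq : Module.finrank ℝ E = 2 * n + s
  /-- the tensor field `φ` of type `(1,1)` -/
  phi : ∀ x : M, TangentSpace 𝓘(ℝ, E) x →L[ℝ] TangentSpace 𝓘(ℝ, E) x
  /-- the vector fields `ξ_1, …, ξ_s` -/
  xi : Fin s → VField E M
  /-- the 1-forms `η^1, …, η^s` -/
  eta : Fin s → ∀ x : M, TangentSpace 𝓘(ℝ, E) x →L[ℝ] ℝ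
  smooth_phi : ContMDiff 𝓘(ℝ, E)
    (𝓘(ℝ, E).prod 𝓘(ℝ, E →L[ℝ] E)) ∞
    (fun x => TotalSpace.mk' (E →L[ℝ] E)
      (E := fun y : M => TangentSpace 𝓘(ℝ, E) y →L[ℝ] TangentSpace 𝓘(ℝ, E) y)
      x (phi x))
  smooth_xi : ∀ i, SmoothField (xi i)
  smooth_eta : ∀ i, ContMDiff 𝓘(ℝ, E)
    (𝓘(ℝ, E).prod 𝓘(ℝ, E →L[ℝ] ℝ)) ∞
    (fun x => TotalSpace.mk' (E →L[ℝ] ℝ)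
      (E := fun y : M => TangentSpace 𝓘(ℝ, E) y →L[ℝ] ℝ) x (eta i x))
  phi_sq : ∀ (x : M) (v : TangentSpace 𝓘(ℝ, E) x),
    phi x (phi x v) = -v + ∑ i, eta i x v • xi i x
  eta_xi : ∀ (x : M) (i j : Fin s), eta i x (xi j x) = if i = j then 1 else 0
  inner_phi : ∀ (x : M) (v w : TangentSpace 𝓘(ℝ, E) x),
    ⟪phi x v, phi x w⟫_ℝ = ⟪v, w⟫_ℝ - ∑ i, eta i x v * eta i x w
  phi_xi : ∀ (x : M) (i : Fin s), phi x (xi i x) = 0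

namespace MetricFStructure

variable {E : Type*} [NormedAddCommGroup E] [NormedSpace ℝ E]
  {n s : ℕ} {M : Type*} [TopologicalSpace M] [ChartedSpace E M]
  [IsManifold 𝓘(ℝ, E) ∞ M] [RiemannianBundle (TanBundle E M)]

/-- The fundamental 2-form `Φ(v, w) = g(v, φ w)`. -/
def fund (S : MetricFStructure E n s M) (x : M) (v w : TangentSpace 𝓘(ℝ, E) x) : ℝ :=
  ⟪v, S.phi x w⟫_ℝ

/-- `dη^i(X, Y) = X η^i(Y) - Y η^i(X) - η^i([X, Y])`. -/
def dEta (S : MetricFStructure E n s M) (i : Fin s) (X Y : VField E M) (x : M) : ℝ :=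
  dirDeriv (fun y => S.eta i y (Y y)) x (X x) - dirDeriv (fun y => S.eta i y (X y)) x (Y x)
    - S.eta i x (mlieBracket 𝓘(ℝ, E) X Y x)

/-- `dΦ(X, Y, Z)`, the cyclic sum of `X Φ(Y, Z) - Φ([X, Y], Z)`. -/
def dFund (S : MetricFStructure E n s M) (X Y Z : VField E M) (x : M) : ℝ :=
  dirDeriv (fun y => S.fund y (Y y) (Z y)) x (X x)
    + dirDeriv (fun y => S.fund y (Z y) (X y)) x (Y x)
    + dirDeriv (fun y => S.fund y (X y) (Y y)) x (Z x)
    - S.fund x (mlieBracket 𝓘(ℝ, E) X Y x) (Z x)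
    - S.fund x (mlieBracket 𝓘(ℝ, E) Y Z x) (X x)
    - S.fund x (mlieBracket 𝓘(ℝ, E) Z X x) (Y x)

/-- The wedge product `(η^i ∧ Φ)(u, v, w)`, normalized like `dFund`. -/
def etaWedgeFund (S : MetricFStructure E n s M) (i : Fin s) (x : M)
    (u v w : TangentSpace 𝓘(ℝ, E) x) : ℝ :=
  S.eta i x u * S.fund x v w + S.eta i x v * S.fund x w u + S.eta i x w * S.fund x u v

/-- The `(2n+s)`-form `η^1 ∧ ⋯ ∧ η^s ∧ Φ^n`, up to a positive constant factor: the
antisymmetrization of `η^1 ⊗ ⋯ ⊗ η^s ⊗ Φ ⊗ ⋯ ⊗ Φ`. -/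
def topForm (S : MetricFStructure E n s M) (x : M)
    (v : Fin s ⊕ (Fin n × Fin 2) → TangentSpace 𝓘(ℝ, E) x) : ℝ :=
  ∑ σ : Equiv.Perm (Fin s ⊕ (Fin n × Fin 2)), ((Equiv.Perm.sign σ : ℤ) : ℝ) *
    ((∏ i : Fin s, S.eta i x (v (σ (Sum.inl i)))) *
      ∏ k : Fin n, S.fund x (v (σ (Sum.inr (k, 0)))) (v (σ (Sum.inr (k, 1)))))

/-- The Nijenhuis tensor
`[φ, φ](X, Y) = φ²[X, Y] + [φ X, φ Y] - φ[φ X, Y] - φ[X, φ Y]`. -/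
def nijenhuis (S : MetricFStructure E n s M) (X Y : VField E M) (x : M) :
    TangentSpace 𝓘(ℝ, E) x :=
  S.phi x (S.phi x (mlieBracket 𝓘(ℝ, E) X Y x))
    + mlieBracket 𝓘(ℝ, E) (fun y => S.phi y (X y)) (fun y => S.phi y (Y y)) x
    - S.phi x (mlieBracket 𝓘(ℝ, E) (fun y => S.phi y (X y)) Y x)
    - S.phi x (mlieBracket 𝓘(ℝ, E) X (fun y => S.phi y (Y y)) x)

/-- Almost `s`-contact metric structure: `η^1 ∧ ⋯ ∧ η^s ∧ Φ^n` vanishes nowhere. -/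
def IsAlmostSContact (S : MetricFStructure E n s M) : Prop :=
  ∀ x : M, ∃ v : Fin s ⊕ (Fin n × Fin 2) → TangentSpace 𝓘(ℝ, E) x, S.topForm x v ≠ 0

/-- Normality: `[φ, φ] + 2 ∑ dη^i ⊗ ξ_i = 0`. -/
def IsNormal (S : MetricFStructure E n s M) : Prop :=
  ∀ (x : M) (X Y : VField E M), DiffFieldAt X x → DiffFieldAt Y x →
    S.nijenhuis X Y x + (2 : ℝ) • ∑ i, S.dEta i X Y x • S.xi i x = 0

/-- Generalized Kenmotsu structures: `s ≥ 1`, the structure is almost `s`-contact metric, all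
`η^i` are closed, `dΦ = 2 ∑ η^i ∧ Φ`, and the structure is normal. -/
structure IsGeneralizedKenmotsu (S : MetricFStructure E n s M) : Prop where
  one_le : 1 ≤ s
  almostSContact : S.IsAlmostSContact
  eta_closed : ∀ (i : Fin s) (x : M) (X Y : VField E M),
    DiffFieldAt X x → DiffFieldAt Y x → S.dEta i X Y x = 0
  dFund_eq : ∀ (x : M) (X Y Z : VField E M),
    DiffFieldAt X x → DiffFieldAt Y x → DiffFieldAt Z x →
    S.dFund X Y Z x = 2 * ∑ i, S.etaWedgeFund i x (X x) (Y x) (Z x)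
  normal : S.IsNormal

end MetricFStructure

/-! ### Submanifolds -/

section Submanifold

variable {E : Type*} [NormedAddCommGroup E] [NormedSpace ℝ E]
    {M : Type*} [TopologicalSpace M] [ChartedSpace E M]
  {F : Type*} [NormedAddCommGroup F] [NormedSpace ℝ F]
  {N : Type*} [TopologicalSpace N] [ChartedSpace F N]

/-- The differential `T_x M → T_{f x} N` of a map `f`. -/
def tmap (f : M → N) (x : M) : TangentSpace 𝓘(ℝ, E) x →L[ℝ] TangentSpace 𝓘(ℝ, F) (f x) :=
  mfderiv 𝓘(ℝ, E) 𝓘(ℝ, F) f x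

/-- `f` is an isometric immersion: it presents `M`, with its Riemannian metric, as an (immersed)
submanifold of `N` with the induced metric. -/
structure IsIsometricImmersion [RiemannianBundle (TanBundle E M)]
    [RiemannianBundle (TanBundle F N)] (f : M → N) : Prop where
  smooth : ContMDiff 𝓘(ℝ, E) 𝓘(ℝ, F) ∞ f
  inner_tmap : ∀ (x : M) (u v : TangentSpace 𝓘(ℝ, E) x),
    ⟪(tmap f x u : TangentSpace 𝓘(ℝ, F) (f x)), tmap f x v⟫_ℝ = ⟪u, v⟫_ℝ

open Classical in
/-- The vector field on `M` that a vector field `V` on `N` tangent to `M` restricts to: its value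
at `x` is the tangent vector of `M` that the differential of `f` sends to `V (f x)`
(and `0` if there is none). -/
def restrictField (f : M → N) (V : VField F N) : VField E M :=
  fun x => if h : ∃ u : TangentSpace 𝓘(ℝ, E) x, tmap f x u = V (f x) then h.choose else 0

end Submanifold

/-- Invariant submanifolds: `φ(T_x M) ⊆ T_x M` for all `x`, and all `ξ_i` are tangent to `M`. -/
structure MetricFStructure.IsInvariantSubmanifold
    {F : Type*} [NormedAddCommGroup F] [NormedSpace ℝ F] {n s : ℕ} {N : Type*} [TopologicalSpace N]
    [ChartedSpace F N] [IsManifold 𝓘(ℝ, F) ∞ N]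
    [RiemannianBundle (TanBundle F N)] (S : MetricFStructure F n s N)
    {E : Type*} [NormedAddCommGroup E] [NormedSpace ℝ E]
    {M : Type*} [TopologicalSpace M] [ChartedSpace E M]
    [RiemannianBundle (TanBundle E M)] (f : M → N) : Prop where
  isometric : IsIsometricImmersion (E := E) (F := F) f
  phi_tangent : ∀ (x : M) (u : TangentSpace 𝓘(ℝ, E) x),
    ∃ v : TangentSpace 𝓘(ℝ, E) x, tmap f x v = S.phi (f x) (tmap f x u)
  xi_tangent : ∀ (i : Fin s) (x : M),
    ∃ v : TangentSpace 𝓘(ℝ, E) x, tmap f x v = S.xi i (f x)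

/-- The vector field `ξ_i`, regarded as a vector field on the invariant submanifold `M`. -/
def MetricFStructure.xiOn
    {F : Type*} [NormedAddCommGroup F] [NormedSpace ℝ F] {n s : ℕ} {N : Type*} [TopologicalSpace N]
    [ChartedSpace F N] [IsManifold 𝓘(ℝ, F) ∞ N]
    [RiemannianBundle (TanBundle F N)] (S : MetricFStructure F n s N)
    {E : Type*} [NormedAddCommGroup E] [NormedSpace ℝ E]
    {M : Type*} [TopologicalSpace M] [ChartedSpace E M] (f : M → N) (i : Fin s) : VField E M :=
  restrictField f (S.xi i)

/-! ### Levi-Civita connection and curvature -/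

/-- `∇` is the Levi-Civita connection of the Riemannian manifold `M`: the smooth connection on
`TM` which is torsion-free and compatible with the metric. In Mathlib's convention,
`∇ Y x (X x)` is `(∇_X Y)(x)`. -/
structure IsLeviCivita {E : Type*} [NormedAddCommGroup E] [NormedSpace ℝ E]
    [FiniteDimensional ℝ E]
    {M : Type*} [TopologicalSpace M] [ChartedSpace E M]
    [IsManifold 𝓘(ℝ, E) ∞ M] [RiemannianBundle (TanBundle E M)]
    (nabla : CovariantDerivative 𝓘(ℝ, E) E (TanBundle E M)) : Prop where
  smooth : nabla.ContMDiffCovariantDerivative ∞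
  torsion_free :
    haveI : CompleteSpace E := FiniteDimensional.complete ℝ E
    nabla.torsion = 0
  metric : ∀ (x : M) (v : TangentSpace 𝓘(ℝ, E) x) (Y Z : VField E M),
    DiffFieldAt Y x → DiffFieldAt Z x →
    dirDeriv (fun y => ⟪Y y, Z y⟫_ℝ) x v = ⟪nabla Y x v, Z x⟫_ℝ + ⟪Y x, nabla Z x v⟫_ℝ

/-- The curvature `R(X, Y)Z = ∇_X ∇_Y Z - ∇_Y ∇_X Z - ∇_{[X, Y]} Z` of a connection. -/
def curvature {E : Type*} [NormedAddCommGroup E] [NormedSpace ℝ E]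
    {M : Type*} [TopologicalSpace M] [ChartedSpace E M]
    [IsManifold 𝓘(ℝ, E) ∞ M]
    (nabla : CovariantDerivative 𝓘(ℝ, E) E (TanBundle E M))
    (X Y Z : VField E M) : VField E M :=
  fun x => nabla (fun y => nabla Z y (Y y)) x (X x) - nabla (fun y => nabla Z y (X y)) x (Y x)
    - nabla Z x (mlieBracket 𝓘(ℝ, E) X Y x)

end

/-! The whole theorem follows from one formula on `M`: every restricted field satisfies `∇_X ξ_i =
PX`, where `P = I - ∑ η^l ⊗ ξ_l` (`orthComponent`) is carried to `-φ²` by the differential of `f`.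

On the ambient manifold, normality and `dη^i = 0` give `L_{ξ_j} φ = 0`. The formula for `dΦ`,
contracted with `ξ_j`, gives `L_{ξ_j} Φ = 2Φ`. Together with `L_{ξ_j} η^i = 0` this yields `(L_{ξ_j}
g)(Y, Z) = 2 g(φY, φZ)` (`IsGeneralizedKenmotsu.lieDeriv_inner`). Closedness of the `η^i` and this
Lie derivative pass to `M`: fields on `M` extend locally to `N`, and brackets of `f`-related fields
are `f`-related (`tmap_mlieBracket_of_related`). Closedness makes `∇ξ_i` self-adjoint, and the Lie
derivative of `g` fixes its symmetric part, so `∇ξ_i = P` (`apply_eq_orthComponent`).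

Differentiating once more gives `R(X, Y)ξ_i` (`curvature_apply`), of which the three formulas with
two or three `ξ`'s are special cases. Finally the first Bianchi identity and the skew-symmetry of
`R(ξ_j, X)` recover `R(ξ_j, X)Y` from `R(X, Y)ξ_j` (`curvature_apply_left`). -/

/-! ### Lie brackets of `f`-related vector fields. -/

noncomputable section Related

open Filter Topology Set

/-- The Lie bracket of related vector fields in normed spaces. -/
lemma fderiv_apply_lieBracket_of_related
    {E F : Type*} [NormedAddCommGroup E] [NormedSpace ℝ E] [NormedAddCommGroup F] [NormedSpace ℝ F]
    {u : E → F} {e : E} (hu : ContDiffAt ℝ 2 u e) {V V' : E → E} {W W' : F → F}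
    (hV : DifferentiableAt ℝ V e) (hV' : DifferentiableAt ℝ V' e)
    (hW : DifferentiableAt ℝ W (u e)) (hW' : DifferentiableAt ℝ W' (u e))
    (h : ∀ᶠ p in 𝓝 e, fderiv ℝ u p (V p) = W (u p))
    (h' : ∀ᶠ p in 𝓝 e, fderiv ℝ u p (V' p) = W' (u p)) :
    fderiv ℝ u e (lieBracket ℝ V V' e) = lieBracket ℝ W W' (u e) := by
  have hdu : DifferentiableAt ℝ (fderiv ℝ u) e :=
    (hu.fderiv_right (m := 1) (by norm_num)).differentiableAt one_ne_zero
  have hu1 : DifferentiableAt ℝ u e := hu.differentiableAt two_ne_zero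
  -- The relation `du(V) = W ∘ u` is differentiated at `e`. When two such identities are subtracted,
  -- the second derivatives of `u` cancel by symmetry.
  have key : ∀ {V : E → E} {W : F → F}, DifferentiableAt ℝ V e → DifferentiableAt ℝ W (u e) →
      (∀ᶠ p in 𝓝 e, fderiv ℝ u p (V p) = W (u p)) → ∀ v,
      fderiv ℝ (fderiv ℝ u) e v (V e) + fderiv ℝ u e (fderiv ℝ V e v) =
        fderiv ℝ W (u e) (fderiv ℝ u e v) := by
    intro V W hV hW h v
    have h1 := (hdu.hasFDerivAt.clm_apply hV.hasFDerivAt).fderiv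
    have h2 := (hW.hasFDerivAt.comp e hu1.hasFDerivAt).fderiv
    have h3 := EventuallyEq.fderiv_eq (𝕜 := ℝ) (f₁ := fun p => fderiv ℝ u p (V p)) (f := W ∘ u) h
    rw [h1, h2] at h3
    have := congr($h3 v)
    simp at this
    rw [← this]; abel
  have hs := (hu.isSymmSndFDerivAt (by simp)).eq (V e) (V' e)
  have k1 := key hV hW h (V' e)
  have k2 := key hV' hW' h' (V e)
  simp only [lieBracket, map_sub, ← h.self_of_nhds, ← h'.self_of_nhds]
  rw [← k1, ← k2, hs]
  abel

variable {E : Type*} [NormedAddCommGroup E] [NormedSpace ℝ E] [CompleteSpace E]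
    {M : Type*} [TopologicalSpace M] [ChartedSpace E M] [IsManifold 𝓘(ℝ, E) ∞ M]
    {F : Type*} [NormedAddCommGroup F] [NormedSpace ℝ F] [CompleteSpace F]
    {N : Type*} [TopologicalSpace N] [ChartedSpace F N] [IsManifold 𝓘(ℝ, F) ∞ N]

/-- A vector field read in the chart at `x`. -/
def chartField (x : M) (V : VField E M) : E → E :=
  mpullbackWithin 𝓘(ℝ, E) 𝓘(ℝ, E) (extChartAt 𝓘(ℝ, E) x).symm V (range 𝓘(ℝ, E))

omit [CompleteSpace E] in
lemma chartField_apply (x : M) (V : VField E M) {q : M}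
    (hq : q ∈ (extChartAt 𝓘(ℝ, E) x).source) :
    chartField x V (extChartAt 𝓘(ℝ, E) x q) =
      mfderiv 𝓘(ℝ, E) 𝓘(ℝ, E) (extChartAt 𝓘(ℝ, E) x) q (V q) := by
  -- The chart sends `q` back to a point only propositionally equal to `q`, so `V` is evaluated
  -- there in another tangent space; a free point `q'` avoids transporting vectors.
  have hV : ∀ q', q' = q → ((mfderivWithin 𝓘(ℝ, E) 𝓘(ℝ, E) (extChartAt 𝓘(ℝ, E) x).symm
      (range 𝓘(ℝ, E)) (extChartAt 𝓘(ℝ, E) x q)).inverse (V q') : E) =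
      mfderiv 𝓘(ℝ, E) 𝓘(ℝ, E) (extChartAt 𝓘(ℝ, E) x) q (V q) := by
    rintro q' rfl
    have h1 := mfderivWithin_extChartAt_symm_comp_mfderiv_extChartAt' (I := 𝓘(ℝ, E)) (x := x) hq
    have h2 := mfderiv_extChartAt_comp_mfderivWithin_extChartAt_symm' (I := 𝓘(ℝ, E)) (x := x) hq
    have : (mfderivWithin 𝓘(ℝ, E) 𝓘(ℝ, E) (extChartAt 𝓘(ℝ, E) x).symm
      (range 𝓘(ℝ, E)) (extChartAt 𝓘(ℝ, E) x q')).inverse =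
        mfderiv 𝓘(ℝ, E) 𝓘(ℝ, E) (extChartAt 𝓘(ℝ, E) x) q' :=
      ContinuousLinearMap.inverse_eq h1 h2
    rw [this]
    rfl
  exact hV _ ((extChartAt 𝓘(ℝ, E) x).left_inv hq)

lemma differentiableAt_chartField {x : M} {V : VField E M} (hV : DiffFieldAt V x) :
    DifferentiableAt ℝ (chartField x V) (extChartAt 𝓘(ℝ, E) x x) := by
  have h : DifferentiableWithinAt ℝ (chartField x V)
      ((extChartAt 𝓘(ℝ, E) x).symm ⁻¹' univ ∩ range 𝓘(ℝ, E)) (extChartAt 𝓘(ℝ, E) x x) :=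
    (mdifferentiableWithinAt_univ.2 hV).differentiableWithinAt_mpullbackWithin_vectorField
  rwa [preimage_univ, univ_inter, ModelWithCorners.Boundaryless.range_eq_univ,
    differentiableWithinAt_univ] at h

omit [CompleteSpace E] in
lemma mlieBracket_eq_chartField {x : M} {V W : VField E M} :
    mfderiv 𝓘(ℝ, E) 𝓘(ℝ, E) (extChartAt 𝓘(ℝ, E) x) x (mlieBracket 𝓘(ℝ, E) V W x) =
      lieBracket ℝ (chartField x V) (chartField x W) (extChartAt 𝓘(ℝ, E) x x) := by
  have h : lieBracketWithin ℝ (chartField x V) (chartField x W)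
      ((extChartAt 𝓘(ℝ, E) x).symm ⁻¹' univ ∩ range 𝓘(ℝ, E)) (extChartAt 𝓘(ℝ, E) x x) =
      lieBracket ℝ (chartField x V) (chartField x W) (extChartAt 𝓘(ℝ, E) x x) := by
    rw [preimage_univ, univ_inter, ModelWithCorners.Boundaryless.range_eq_univ,
      lieBracketWithin_univ]
  rw [← h]
  exact (((isInvertible_mfderiv_extChartAt (I := 𝓘(ℝ, E))
    (mem_extChartAt_source x)).inverse_apply_eq).1 rfl).symm

/-- The Lie brackets of `f`-related vector fields are `f`-related. -/
theorem tmap_mlieBracket_of_related {f : M → N} {x : M}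
    (hf : ContMDiffAt 𝓘(ℝ, E) 𝓘(ℝ, F) 2 f x)
    {X X' : VField E M} {Y Y' : VField F N}
    (hX : DiffFieldAt X x) (hX' : DiffFieldAt X' x)
    (hY : DiffFieldAt Y (f x)) (hY' : DiffFieldAt Y' (f x))
    (h : ∀ᶠ p in 𝓝 x, tmap f p (X p) = Y (f p))
    (h' : ∀ᶠ p in 𝓝 x, tmap f p (X' p) = Y' (f p)) :
    tmap f x (mlieBracket 𝓘(ℝ, E) X X' x) = mlieBracket 𝓘(ℝ, F) Y Y' (f x) := by
  set φ := extChartAt 𝓘(ℝ, E) x with hφ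
  set ψ := extChartAt 𝓘(ℝ, F) (f x) with hψ
  set u : E → F := ψ ∘ f ∘ φ.symm with hu
  have hx : φ.symm (φ x) = x := extChartAt_to_inv x
  have hux : u (φ x) = ψ (f x) := by simp [u, hx]
  have hCu : ContDiffAt ℝ 2 u (φ x) := by
    have := (contMDiffAt_iff.1 hf).2
    rw [ModelWithCorners.Boundaryless.range_eq_univ, contDiffWithinAt_univ] at this
    exact this
  have hf1 : ∀ᶠ p in 𝓝 x, MDifferentiableAt 𝓘(ℝ, E) 𝓘(ℝ, F) f p := by
    filter_upwards [(contMDiffAt_iff_contMDiffAt_nhds (by simp)).1 hf] with p hp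
    exact hp.mdifferentiableAt two_ne_zero
  have hsrc : ∀ᶠ p in 𝓝 x, p ∈ φ.source ∧ f p ∈ ψ.source :=
    Filter.Eventually.and (extChartAt_source_mem_nhds x)
      (hf.continuousAt.eventually (extChartAt_source_mem_nhds (f x)))
  -- Chain rule for `u ∘ φ = ψ ∘ f`: in charts, the differential of `f` is `fderiv ℝ u`. It turns
  -- relatedness on the manifolds into relatedness of the chart fields.
  have key : ∀ p, MDifferentiableAt 𝓘(ℝ, E) 𝓘(ℝ, F) f p → p ∈ φ.source → f p ∈ ψ.source →
      ∀ v : TangentSpace 𝓘(ℝ, E) p, fderiv ℝ u (φ p) (mfderiv 𝓘(ℝ, E) 𝓘(ℝ, E) φ p v) =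
      mfderiv 𝓘(ℝ, F) 𝓘(ℝ, F) ψ (f p) (tmap f p v) := by
    intro p hfp hp hfp' v
    have hpp : φ.symm (φ p) = p := φ.left_inv hp
    have e1 : MDifferentiableAt 𝓘(ℝ, E) 𝓘(ℝ, E) φ p :=
      mdifferentiableAt_extChartAt (by simpa [φ] using hp)
    have e2 : MDifferentiableAt 𝓘(ℝ, F) 𝓘(ℝ, F) ψ (f p) :=
      mdifferentiableAt_extChartAt (by simpa [ψ] using hfp')
    have e3 : MDifferentiableAt 𝓘(ℝ, E) 𝓘(ℝ, E) φ.symm (φ p) := by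
      have := mdifferentiableWithinAt_extChartAt_symm (I := 𝓘(ℝ, E)) (x := x)
        (φ.map_source hp)
      rwa [ModelWithCorners.Boundaryless.range_eq_univ, mdifferentiableWithinAt_univ] at this
    have e4 : MDifferentiableAt 𝓘(ℝ, E) 𝓘(ℝ, F) u (φ p) := by
      refine MDifferentiableAt.comp (φ p) (I' := 𝓘(ℝ, F)) (g := ψ) (f := f ∘ φ.symm)
        (by simpa [hpp] using e2) ?_
      exact MDifferentiableAt.comp (φ p) (I' := 𝓘(ℝ, E)) (by simpa [hpp] using hfp) e3
    have c1 : HasMFDerivAt 𝓘(ℝ, E) 𝓘(ℝ, F) (u ∘ φ) p _ :=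
      HasMFDerivAt.comp p e4.hasMFDerivAt e1.hasMFDerivAt
    have c2 : HasMFDerivAt 𝓘(ℝ, E) 𝓘(ℝ, F) (ψ ∘ f) p _ :=
      HasMFDerivAt.comp p e2.hasMFDerivAt hfp.hasMFDerivAt
    have heq : u ∘ φ =ᶠ[𝓝 p] ψ ∘ f := by
      filter_upwards [(isOpen_extChartAt_source (I := 𝓘(ℝ, E)) x).mem_nhds hp] with q hq
      simp [u, φ.left_inv hq]
    have c3 := hasMFDerivAt_unique (c1.congr_of_eventuallyEq heq.symm) c2
    have := congr($c3 v)
    rw [mfderiv_eq_fderiv] at this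
    exact this
  have rel : ∀ {X : VField E M} {Y : VField F N}, (∀ᶠ p in 𝓝 x, tmap f p (X p) = Y (f p)) →
      ∀ᶠ e in 𝓝 (φ x), fderiv ℝ u e (chartField x X e) = chartField (f x) Y (u e) := by
    intro X Y h
    have hc : Tendsto φ.symm (𝓝 (φ x)) (𝓝 x) := by
      have := continuousAt_extChartAt_symm (I := 𝓘(ℝ, E)) x
      rw [ContinuousAt, extChartAt_to_inv] at this
      exact this
    have ht : φ.target ∈ 𝓝 (φ x) := by
      have := extChartAt_target_mem_nhdsWithin (I := 𝓘(ℝ, E)) x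
      rwa [ModelWithCorners.Boundaryless.range_eq_univ, nhdsWithin_univ] at this
    filter_upwards [hc.eventually (h.and (hf1.and hsrc)), ht] with e ⟨h1, h2, h3, h4⟩ he
    obtain ⟨p, hp, rfl⟩ : ∃ p ∈ φ.source, φ p = e := ⟨φ.symm e, h3, φ.right_inv he⟩
    rw [φ.left_inv hp] at h1 h2 h4
    have : u (φ p) = ψ (f p) := by simp [u, φ.left_inv hp]
    rw [chartField_apply x X hp, key p h2 hp h4, this, chartField_apply (f x) Y h4, h1]
  have main := fderiv_apply_lieBracket_of_related hCu (differentiableAt_chartField hX)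
    (differentiableAt_chartField hX') (by rw [hux]; exact differentiableAt_chartField hY)
    (by rw [hux]; exact differentiableAt_chartField hY') (rel h) (rel h')
  rw [hux, ← mlieBracket_eq_chartField, ← mlieBracket_eq_chartField,
    key x hf1.self_of_nhds (mem_extChartAt_source x) (mem_extChartAt_source (f x))] at main
  exact (isInvertible_mfderiv_extChartAt (I := 𝓘(ℝ, F))
    (mem_extChartAt_source (f x))).injective main

end Related

/-! ### Immersions: local left inverses, restriction and extension of vector fields. -/

noncomputable section Immersions

open Filter Topology Set

variable {E : Type*} [NormedAddCommGroup E] [NormedSpace ℝ E]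
    {M : Type*} [TopologicalSpace M] [ChartedSpace E M] [IsManifold 𝓘(ℝ, E) ∞ M]
    {F : Type*} [NormedAddCommGroup F] [NormedSpace ℝ F]
    {N : Type*} [TopologicalSpace N] [ChartedSpace F N] [IsManifold 𝓘(ℝ, F) ∞ N]

/-- A map whose derivative at a point is injective has a smooth local left inverse. -/
theorem exists_contDiffAt_leftInverse [FiniteDimensional ℝ E] [FiniteDimensional ℝ F]
    {u : E → F} {e : E} {n : WithTop ℕ∞} (hn : n ≠ 0) (hu : ContDiffAt ℝ n u e)
    (hinj : Function.Injective (fderiv ℝ u e)) :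
    ∃ h : F → E, ContDiffAt ℝ n h (u e) ∧ ∀ᶠ p in 𝓝 e, h (u p) = p := by
  have : CompleteSpace E := FiniteDimensional.complete ℝ E
  -- With `B` a linear left inverse of the derivative, `B ∘ u` has derivative the identity at `e`.
  -- The inverse function theorem applies to it, and its local inverse composed with `B` is the
  -- required map.
  obtain ⟨B, hB⟩ := (fderiv ℝ u e : E →ₗ[ℝ] F).exists_leftInverse_of_injective
    (LinearMap.ker_eq_bot.2 hinj)
  set B' : F →L[ℝ] E := LinearMap.toContinuousLinearMap B with hB'
  have hv : ContDiffAt ℝ n (B' ∘ u) e := B'.contDiff.contDiffAt.comp e hu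
  have hd : HasFDerivAt (B' ∘ u) ((ContinuousLinearEquiv.refl ℝ E : E ≃L[ℝ] E) : E →L[ℝ] E) e := by
    have := B'.hasFDerivAt.comp e (hu.differentiableAt hn).hasFDerivAt
    convert this using 1
    ext v
    exact (congr($hB v)).symm
  refine ⟨hv.localInverse hd hn ∘ B', ?_, ?_⟩
  · exact (hv.to_localInverse hd hn).comp (u e) B'.contDiff.contDiffAt
  · exact (hv.hasStrictFDerivAt' hd hn).eventually_left_inverse

omit [IsManifold 𝓘(ℝ, E) ∞ M] [IsManifold 𝓘(ℝ, F) ∞ N] in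
/-- An immersion has a smooth local left inverse. -/
theorem exists_contMDiffAt_leftInverse [FiniteDimensional ℝ E] [FiniteDimensional ℝ F]
    {f : M → N} {x : M} {n : WithTop ℕ∞} (hn : n ≠ 0) [IsManifold 𝓘(ℝ, E) n M]
    [IsManifold 𝓘(ℝ, F) n N]
    (hf : ContMDiffAt 𝓘(ℝ, E) 𝓘(ℝ, F) n f x)
    (hinj : Function.Injective (tmap (E := E) (F := F) f x)) :
    ∃ h : N → M, ContMDiffAt 𝓘(ℝ, F) 𝓘(ℝ, E) n h (f x) ∧ ∀ᶠ p in 𝓝 x, h (f p) = p := by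
  set φ := extChartAt 𝓘(ℝ, E) x with hφ
  set ψ := extChartAt 𝓘(ℝ, F) (f x) with hψ
  set u : E → F := ψ ∘ f ∘ φ.symm with hu
  have hx : φ.symm (φ x) = x := extChartAt_to_inv x
  have hux : u (φ x) = ψ (f x) := by simp [u, hx]
  have hCu : ContDiffAt ℝ n u (φ x) := by
    have := (contMDiffAt_iff.1 hf).2
    rw [ModelWithCorners.Boundaryless.range_eq_univ, contDiffWithinAt_univ] at this
    exact this
  have hdu : Function.Injective (fderiv ℝ u (φ x)) := by
    have := (hf.mdifferentiableAt hn).mfderiv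
    rw [ModelWithCorners.Boundaryless.range_eq_univ, fderivWithin_univ] at this
    rw [tmap, this] at hinj
    exact hinj
  obtain ⟨h, hh, hhu⟩ := exists_contDiffAt_leftInverse hn hCu hdu
  have hhx : h (ψ (f x)) = φ x := by rw [← hux]; exact hhu.self_of_nhds
  refine ⟨φ.symm ∘ h ∘ ψ, ?_, ?_⟩
  · have h1 : ContMDiffAt 𝓘(ℝ, F) 𝓘(ℝ, F) n ψ (f x) := contMDiffAt_extChartAt
    have h2 : ContMDiffAt 𝓘(ℝ, F) 𝓘(ℝ, E) n h (ψ (f x)) := by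
      rw [← hux]; exact hh.contMDiffAt
    have h3 : ContMDiffAt 𝓘(ℝ, E) 𝓘(ℝ, E) n φ.symm (h (ψ (f x))) := by
      rw [hhx]
      have := contMDiffWithinAt_extChartAt_symm_range (I := 𝓘(ℝ, E)) (n := n) x
        (mem_extChartAt_target x)
      rwa [ModelWithCorners.Boundaryless.range_eq_univ, contMDiffWithinAt_univ] at this
    exact h3.comp (f x) (h2.comp (f x) h1)
  · have hc : Tendsto φ (𝓝 x) (𝓝 (φ x)) := continuousAt_extChartAt x
    filter_upwards [hc.eventually hhu, extChartAt_source_mem_nhds (I := 𝓘(ℝ, E)) x] with p hp hps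
    have : u (φ p) = ψ (f p) := by simp [u, φ.left_inv hps]
    simp [← this, hp, φ.left_inv hps]

/-- The bundled derivative is smooth near a point where the map is. -/
lemma contMDiffAt_tangentMap {h : N → M} {y : N} {n : ℕ}
    (hh : ContMDiffAt 𝓘(ℝ, F) 𝓘(ℝ, E) (n + 1) h y) (v : TangentSpace 𝓘(ℝ, F) y) :
    ContMDiffAt 𝓘(ℝ, F).tangent 𝓘(ℝ, E).tangent n (tangentMap 𝓘(ℝ, F) 𝓘(ℝ, E) h)
      (⟨y, v⟩ : TangentBundle 𝓘(ℝ, F) N) := by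
  have : IsManifold 𝓘(ℝ, F) (n + 1 : ℕ) N := inferInstance
  have : IsManifold 𝓘(ℝ, E) (n + 1 : ℕ) M := inferInstance
  have hh' : ContMDiffAt 𝓘(ℝ, F) 𝓘(ℝ, E) (n + 1 : ℕ) h y := by exact_mod_cast hh
  obtain ⟨w, hw, hwy⟩ := (contMDiffAt_iff_contMDiffOn_nhds
    (by norm_cast; exact ENat.natCast_ne_top _)).1 hh'
  obtain ⟨w', hw'w, hw', hyw'⟩ := mem_nhds_iff.1 hw
  have h1 := (hwy.mono hw'w).contMDiffOn_tangentMapWithin (m := n) (by norm_cast)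
    hw'.uniqueMDiffOn
  have hopen : IsOpen (π F (TangentSpace 𝓘(ℝ, F) : N → Type _) ⁻¹' w') :=
    hw'.preimage (FiberBundle.continuous_proj F _)
  have h2 := h1.contMDiffAt (hopen.mem_nhds (x := ⟨y, v⟩) hyw')
  refine h2.congr_of_eventuallyEq ?_
  filter_upwards [hopen.mem_nhds (x := (⟨y, v⟩ : TangentBundle 𝓘(ℝ, F) N)) hyw'] with p hp
  exact (tangentMapWithin_eq_tangentMap (hw'.uniqueMDiffOn _ hp)
    (((hwy.mono hw'w).contMDiffAt (hw'.mem_nhds hp)).mdifferentiableAt (by norm_cast))).symm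

/-- A smooth vector field on the ambient manifold that is tangent to an immersed submanifold
restricts to a smooth vector field. -/
theorem smoothField_restrictField [FiniteDimensional ℝ E] [FiniteDimensional ℝ F] {f : M → N}
    (hf : ContMDiff 𝓘(ℝ, E) 𝓘(ℝ, F) ∞ f)
    (hinj : ∀ x, Function.Injective (tmap (E := E) (F := F) f x))
    {V : VField F N} (hV : SmoothField V) {W : VField E M}
    (hW : ∀ x, tmap f x (W x) = V (f x)) : SmoothField W := by
  rw [SmoothField, contMDiff_infty]
  intro n x
  -- Since `h ∘ f = id` near `x`, there `W = dh(V ∘ f)`. Passing to `dh` costs one derivative, hence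
  -- the order `n + 1`.
  obtain ⟨h, hh, hhf⟩ := exists_contMDiffAt_leftInverse (n := (n + 1 : ℕ)) (by norm_cast)
    (hf.contMDiffAt.of_le (mod_cast le_top)) (hinj x)
  have h1 : ContMDiffAt 𝓘(ℝ, E) 𝓘(ℝ, F).tangent n
      (fun p => (⟨f p, V (f p)⟩ : TangentBundle 𝓘(ℝ, F) N)) x :=
    ((hV (f x)).of_le (mod_cast le_top)).comp x (hf.contMDiffAt.of_le (mod_cast le_top))
  have h2 := (contMDiffAt_tangentMap (n := n) (by exact_mod_cast hh) (V (f x))).comp x h1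
  refine h2.congr_of_eventuallyEq ?_
  have hhd : ∀ᶠ p in 𝓝 x, MDifferentiableAt 𝓘(ℝ, F) 𝓘(ℝ, E) h (f p) := by
    refine hf.continuous.continuousAt.eventually
      (p := fun y => MDifferentiableAt 𝓘(ℝ, F) 𝓘(ℝ, E) h y) ?_
    filter_upwards [(contMDiffAt_iff_contMDiffAt_nhds
      (by norm_cast; exact ENat.natCast_ne_top _)).1 hh] with y hy
    exact hy.mdifferentiableAt (by norm_cast)
  filter_upwards [hhf.eventually_nhds, hhd] with p hp hpd
  have hpf : MDifferentiableAt 𝓘(ℝ, E) 𝓘(ℝ, F) f p := hf.mdifferentiableAt (by simp)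
  have key := tangentMap_comp_at (⟨p, W p⟩ : TangentBundle 𝓘(ℝ, E) M) hpd hpf
  have hid : h ∘ f =ᶠ[𝓝 p] id := hp
  have : tangentMap 𝓘(ℝ, E) 𝓘(ℝ, E) (h ∘ f) (⟨p, W p⟩ : TangentBundle 𝓘(ℝ, E) M) = ⟨p, W p⟩ := by
    have e1 := hid.mfderiv_eq (I := 𝓘(ℝ, E)) (I' := 𝓘(ℝ, E))
    have e2 : h (f p) = p := hp.self_of_nhds
    rw [tangentMap, e1, mfderiv_id]
    refine TotalSpace.ext e2 ?_
    exact HEq.rfl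
  rw [this] at key
  rw [key]
  simp only [tangentMap, Function.comp]
  rw [← hW]
  rfl

/-- A vector field on an immersed submanifold that is differentiable at a point extends, locally
around that point, to the ambient manifold. -/
theorem exists_diffFieldAt_extension [FiniteDimensional ℝ E] [FiniteDimensional ℝ F] {f : M → N}
    (hf : ContMDiff 𝓘(ℝ, E) 𝓘(ℝ, F) ∞ f) {x : M}
    (hinj : Function.Injective (tmap (E := E) (F := F) f x))
    {X : VField E M} (hX : DiffFieldAt X x) :
    ∃ Y : VField F N, DiffFieldAt Y (f x) ∧ ∀ᶠ p in 𝓝 x, tmap f p (X p) = Y (f p) := by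
  obtain ⟨h, hh, hhf⟩ := exists_contMDiffAt_leftInverse (n := 1) one_ne_zero
    (hf.contMDiffAt.of_le (by simp)) hinj
  set t := trivializationAt F (TangentSpace 𝓘(ℝ, F) : N → Type _) (f x) with ht
  set c : M → F := fun p => (t (tangentMap 𝓘(ℝ, E) 𝓘(ℝ, F) f ⟨p, X p⟩)).2 with hc
  have hcd : MDifferentiableAt 𝓘(ℝ, E) 𝓘(ℝ, F) c x := by
    have h1 : MDifferentiableAt 𝓘(ℝ, E).tangent 𝓘(ℝ, F).tangent (tangentMap 𝓘(ℝ, E) 𝓘(ℝ, F) f)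
        (⟨x, X x⟩ : TangentBundle 𝓘(ℝ, E) M) :=
      ((hf.contMDiff_tangentMap (m := 1) (by norm_cast)) _).mdifferentiableAt
        one_ne_zero
    have h2 := MDifferentiableAt.comp x h1 hX
    exact ((mdifferentiableAt_totalSpace _ _).1 h2).2
  have hbase : t.baseSet ∈ 𝓝 (f x) :=
    t.open_baseSet.mem_nhds (FiberBundle.mem_baseSet_trivializationAt' (f x))
  have hhx : h (f x) = x := hhf.self_of_nhds
  -- The fibre coordinate `c` of `df(X)` lives on `M`; precomposing it with the left inverse `h`
  -- makes it a function on `N` with the same values along `f`.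
  refine ⟨fun y => t.symm y (c (h y)), ?_, ?_⟩
  · rw [DiffFieldAt]
    refine (mdifferentiableAt_section _ _).2 ?_
    have h1 : MDifferentiableAt 𝓘(ℝ, F) 𝓘(ℝ, F) (c ∘ h) (f x) :=
      MDifferentiableAt.comp (f x) (by rw [hhx]; exact hcd) (hh.mdifferentiableAt one_ne_zero)
    refine h1.congr_of_eventuallyEq ?_
    filter_upwards [hbase] with y hy
    have := t.apply_mk_symm hy (c (h y))
    change (t ⟨y, t.symm y (c (h y))⟩).2 = c (h y)
    rw [this]
  · filter_upwards [hhf, hf.continuous.continuousAt.eventually hbase] with p hp hpb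
    simp only [hp, c]
    exact (t.symm_apply_apply_mk hpb (tmap f p (X p))).symm

end Immersions

/-! ### Calculus of directional derivatives. -/

noncomputable section DirDeriv

open Filter Topology Set

variable {E : Type*} [NormedAddCommGroup E] [NormedSpace ℝ E]
    {M : Type*} [TopologicalSpace M] [ChartedSpace E M]

lemma dirDeriv_eq_mvfderiv (u : M → ℝ) (x : M) (v : TangentSpace 𝓘(ℝ, E) x) :
    dirDeriv u x v = mvfderiv 𝓘(ℝ, E) u x v := rfl

@[simp] lemma dirDeriv_const (c : ℝ) (x : M) (v : TangentSpace 𝓘(ℝ, E) x) :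
    dirDeriv (fun _ : M => c) x v = 0 := by
  rw [dirDeriv_eq_mvfderiv, mvfderiv_const]; rfl

lemma dirDeriv_add {u w : M → ℝ} {x : M} (hu : MDifferentiableAt 𝓘(ℝ, E) 𝓘(ℝ, ℝ) u x)
    (hw : MDifferentiableAt 𝓘(ℝ, E) 𝓘(ℝ, ℝ) w x) (v : TangentSpace 𝓘(ℝ, E) x) :
    dirDeriv (fun y => u y + w y) x v = dirDeriv u x v + dirDeriv w x v := by
  simp only [dirDeriv_eq_mvfderiv]
  exact congr($(mvfderiv_add hu hw) v)

lemma dirDeriv_sub {u w : M → ℝ} {x : M} (hu : MDifferentiableAt 𝓘(ℝ, E) 𝓘(ℝ, ℝ) u x)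
    (hw : MDifferentiableAt 𝓘(ℝ, E) 𝓘(ℝ, ℝ) w x) (v : TangentSpace 𝓘(ℝ, E) x) :
    dirDeriv (fun y => u y - w y) x v = dirDeriv u x v - dirDeriv w x v := by
  simp only [dirDeriv_eq_mvfderiv]
  exact congr($(mvfderiv_sub hu hw) v)

lemma dirDeriv_mul {u w : M → ℝ} {x : M} (hu : MDifferentiableAt 𝓘(ℝ, E) 𝓘(ℝ, ℝ) u x)
    (hw : MDifferentiableAt 𝓘(ℝ, E) 𝓘(ℝ, ℝ) w x) (v : TangentSpace 𝓘(ℝ, E) x) :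
    dirDeriv (fun y => u y * w y) x v = u x * dirDeriv w x v + w x * dirDeriv u x v := by
  simp only [dirDeriv_eq_mvfderiv]
  exact congr($(mvfderiv_mul hu hw) v)

lemma mdifferentiableAt_finset_sum {ι : Type*} (s : Finset ι) {u : ι → M → ℝ} {x : M}
    (hu : ∀ i ∈ s, MDifferentiableAt 𝓘(ℝ, E) 𝓘(ℝ, ℝ) (u i) x) :
    MDifferentiableAt 𝓘(ℝ, E) 𝓘(ℝ, ℝ) (fun y => ∑ i ∈ s, u i y) x := by
  classical
  induction s using Finset.induction_on with
  | empty => simpa using mdifferentiableAt_const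
  | insert a s ha ih =>
    simp only [Finset.sum_insert ha]
    exact (hu a (by simp)).add (ih fun i hi => hu i (by simp [hi]))

lemma dirDeriv_sum {ι : Type*} (s : Finset ι) {u : ι → M → ℝ} {x : M}
    (hu : ∀ i ∈ s, MDifferentiableAt 𝓘(ℝ, E) 𝓘(ℝ, ℝ) (u i) x) (v : TangentSpace 𝓘(ℝ, E) x) :
    dirDeriv (fun y => ∑ i ∈ s, u i y) x v = ∑ i ∈ s, dirDeriv (u i) x v := by
  classical
  induction s using Finset.induction_on with
  | empty => simp
  | insert a s ha ih =>
    simp only [Finset.sum_insert ha]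
    rw [dirDeriv_add (hu a (by simp))
      (mdifferentiableAt_finset_sum s fun i hi => hu i (by simp [hi])),
      ih fun i hi => hu i (by simp [hi])]

lemma dirDeriv_congr {u w : M → ℝ} {x : M} (h : u =ᶠ[𝓝 x] w) (v : TangentSpace 𝓘(ℝ, E) x) :
    dirDeriv u x v = dirDeriv w x v := by
  rw [dirDeriv, dirDeriv, h.mfderiv_eq]
  rfl

lemma dirDeriv_comp {F : Type*} [NormedAddCommGroup F] [NormedSpace ℝ F]
    {N : Type*} [TopologicalSpace N] [ChartedSpace F N] {f : M → N} {u : N → ℝ} {x : M}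
    (hu : MDifferentiableAt 𝓘(ℝ, F) 𝓘(ℝ, ℝ) u (f x))
    (hf : MDifferentiableAt 𝓘(ℝ, E) 𝓘(ℝ, F) f x) (v : TangentSpace 𝓘(ℝ, E) x) :
    dirDeriv (fun p => u (f p)) x v = dirDeriv (E := F) u (f x) (tmap f x v) := by
  have := mfderiv_comp (I' := 𝓘(ℝ, F)) x hu hf
  exact congr($this v)

end DirDeriv

/-! ### Metric `f`-structures: algebra, and Lie derivatives along `ξ_j` in the Kenmotsu case. -/

namespace MetricFStructure

variable {E : Type*} [NormedAddCommGroup E] [NormedSpace ℝ E]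
  {n s : ℕ} {M : Type*} [TopologicalSpace M] [ChartedSpace E M]
  [IsManifold 𝓘(ℝ, E) ∞ M] [RiemannianBundle (TanBundle E M)]

section Algebra

variable (S : MetricFStructure E n s M) (x : M)

lemma inner_xi (v : TangentSpace 𝓘(ℝ, E) x) (j : Fin s) : ⟪v, S.xi j x⟫_ℝ = S.eta j x v := by
  have h := S.inner_phi x v (S.xi j x)
  rw [S.phi_xi, inner_zero_right] at h
  simp [S.eta_xi] at h
  linarith

/-- Evaluating `φ³v` as `φ²(φv)` and as `φ(φ²v)` leaves `∑ η^i(φv) ξ_i = 0`, and the `η^j` separate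
the `ξ_i`. -/
lemma eta_phi (j : Fin s) (v : TangentSpace 𝓘(ℝ, E) x) : S.eta j x (S.phi x v) = 0 := by
  have h1 := S.phi_sq x (S.phi x v)
  have h2 := congr_arg (S.phi x) (S.phi_sq x v)
  rw [h2] at h1
  simp only [map_add, map_neg, map_sum, map_smul, S.phi_xi, smul_zero, Finset.sum_const_zero,
    add_zero] at h1
  have h3 : ∑ i, S.eta i x (S.phi x v) • S.xi i x = 0 := by simpa using h1.symm
  have h4 := congr_arg (S.eta j x) h3
  simpa [S.eta_xi] using h4

lemma inner_phi_right (v w : TangentSpace 𝓘(ℝ, E) x) :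
    ⟪v, S.phi x w⟫_ℝ = -⟪S.phi x v, w⟫_ℝ := by
  have h := S.inner_phi x v (S.phi x w)
  rw [S.phi_sq] at h
  simp [eta_phi, inner_add_right, inner_sum, inner_smul_right, inner_xi] at h
  exact h.symm

lemma eq_zero_of_phi_sq_of_eta {v : TangentSpace 𝓘(ℝ, E) x} (h : S.phi x (S.phi x v) = 0)
    (h' : ∀ i, S.eta i x v = 0) : v = 0 := by
  rw [S.phi_sq] at h
  simpa [h'] using h

end Algebra

section Differentiability

variable (S : MetricFStructure E n s M) {x : M} {Y Z : VField E M}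

lemma diffFieldAt_xi (i : Fin s) : DiffFieldAt (S.xi i) x :=
  (S.smooth_xi i).mdifferentiable (by simp) x

lemma diffFieldAt_phi (hY : DiffFieldAt Y x) : DiffFieldAt (fun y => S.phi y (Y y)) x :=
  MDifferentiableAt.clm_bundle_apply (F₁ := E) (F₂ := E)
    (S.smooth_phi.mdifferentiable (by simp) x) hY

lemma mdifferentiableAt_eta (i : Fin s) (hY : DiffFieldAt Y x) :
    MDifferentiableAt 𝓘(ℝ, E) 𝓘(ℝ, ℝ) (fun y => S.eta i y (Y y)) x := by
  have : MDifferentiableAt 𝓘(ℝ, E) (𝓘(ℝ, E).prod 𝓘(ℝ, ℝ))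
      (fun m => TotalSpace.mk' ℝ (E := Bundle.Trivial M ℝ) m (S.eta i m (Y m))) x :=
    MDifferentiableAt.clm_bundle_apply (F₁ := E) (F₂ := ℝ)
      (S.smooth_eta i |>.mdifferentiable (by simp) x) hY
  simp only [mdifferentiableAt_totalSpace] at this
  exact this.2

end Differentiability

section Kenmotsu

variable {S : MetricFStructure E n s M} {x : M} {Y Z : VField E M}

/-- `η^i([ξ_j, Y]) = ξ_j η^i(Y)`. -/
lemma IsGeneralizedKenmotsu.eta_mlieBracket_xi (hS : S.IsGeneralizedKenmotsu) (i j : Fin s)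
    (hY : DiffFieldAt Y x) :
    S.eta i x (mlieBracket 𝓘(ℝ, E) (S.xi j) Y x) =
      dirDeriv (fun y => S.eta i y (Y y)) x (S.xi j x) := by
  -- As `η^i(ξ_j)` is constant, one of the two derivative terms of `dη^i(ξ_j, Y)` drops out.
  have h := hS.eta_closed i x (S.xi j) Y (S.diffFieldAt_xi j) hY
  have h' : (fun y => S.eta i y (S.xi j y)) = fun _ => if i = j then 1 else 0 := by
    ext y; exact S.eta_xi y i j
  rw [dEta, h', dirDeriv_const] at h
  linarith

/-- The Lie derivative of `φ` along `ξ_j` vanishes. -/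
lemma IsGeneralizedKenmotsu.mlieBracket_xi_phi (hS : S.IsGeneralizedKenmotsu) (j : Fin s)
    (hY : DiffFieldAt Y x) :
    mlieBracket 𝓘(ℝ, E) (S.xi j) (fun y => S.phi y (Y y)) x =
      S.phi x (mlieBracket 𝓘(ℝ, E) (S.xi j) Y x) := by
  -- Because `φξ_j = 0` and `dη^i = 0`, normality reduces to `φ(φ[ξ_j, Y] - [ξ_j, φY]) = 0`. The
  -- vector in brackets is also annihilated by every `η^i`, so it vanishes.
  have h := hS.normal x (S.xi j) Y (S.diffFieldAt_xi j) hY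
  have h0 : (fun y => S.phi y (S.xi j y)) = 0 := by ext y; exact S.phi_xi y j
  rw [nijenhuis, h0] at h
  simp only [hS.eta_closed _ x (S.xi j) Y (S.diffFieldAt_xi j) hY, zero_smul,
    Finset.sum_const_zero, smul_zero, add_zero, mlieBracket_zero_left, Pi.zero_apply, map_zero,
    sub_zero] at h
  symm
  rw [← sub_eq_zero]
  have hη : ∀ i, S.eta i x (mlieBracket 𝓘(ℝ, E) (S.xi j) (fun y => S.phi y (Y y)) x) = 0 := by
    intro i
    rw [hS.eta_mlieBracket_xi i j (S.diffFieldAt_phi hY)]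
    simp only [eta_phi, dirDeriv_const]
  refine S.eq_zero_of_phi_sq_of_eta x ?_ fun i => ?_
  · rw [map_sub, h, map_zero]
  · rw [map_sub, hη, eta_phi, sub_zero]

/-- This is `L_{ξ_j} Φ = 2Φ`. In `dΦ(ξ_j, Y, Z)` all terms where `ξ_j` enters `Φ` vanish, and
`η^i(ξ_j) = δ_{ij}` keeps a single summand of `2 ∑ η^i ∧ Φ`. The remaining bracket term is moved
through `φ` by skew-symmetry and `L_{ξ_j} φ = 0`. -/
lemma IsGeneralizedKenmotsu.lieDeriv_inner_phi (hS : S.IsGeneralizedKenmotsu) (j : Fin s)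
    (hY : DiffFieldAt Y x) (hZ : DiffFieldAt Z x) :
    dirDeriv (fun y => ⟪Y y, S.phi y (Z y)⟫_ℝ) x (S.xi j x)
      - ⟪mlieBracket 𝓘(ℝ, E) (S.xi j) Y x, S.phi x (Z x)⟫_ℝ
      - ⟪Y x, mlieBracket 𝓘(ℝ, E) (S.xi j) (fun y => S.phi y (Z y)) x⟫_ℝ =
      2 * ⟪Y x, S.phi x (Z x)⟫_ℝ := by
  have h := hS.dFund_eq x (S.xi j) Y Z (S.diffFieldAt_xi j) hY hZ
  have h1 : ∀ y (v : TangentSpace 𝓘(ℝ, E) y), S.fund y v (S.xi j y) = 0 := by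
    intro y v; rw [fund, S.phi_xi, inner_zero_right]
  have h2 : ∀ y (v : TangentSpace 𝓘(ℝ, E) y), S.fund y (S.xi j y) v = 0 := by
    intro y v; rw [fund, real_inner_comm, inner_xi, eta_phi]
  simp only [dFund, etaWedgeFund, h1, h2, dirDeriv_const, mul_zero, add_zero, sub_zero,
    S.eta_xi, ite_mul, one_mul, zero_mul, Finset.sum_ite_eq', Finset.mem_univ, if_true,
    mlieBracket_swap_apply (V := Z)] at h
  simp only [fund, inner_neg_left] at h
  have e : ⟪Y x, S.phi x (mlieBracket 𝓘(ℝ, E) (S.xi j) Z x)⟫_ℝ =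
      -⟪mlieBracket 𝓘(ℝ, E) (S.xi j) Z x, S.phi x (Y x)⟫_ℝ := by
    rw [inner_phi_right, real_inner_comm]
  rw [hS.mlieBracket_xi_phi j hZ, e]
  exact h

variable [IsContMDiffRiemannianBundle 𝓘(ℝ, E) ∞ E (TanBundle E M)]

/-- The Lie derivative of the metric along `ξ_j`. -/
theorem IsGeneralizedKenmotsu.lieDeriv_inner (hS : S.IsGeneralizedKenmotsu) (j : Fin s)
    (hY : DiffFieldAt Y x) (hZ : DiffFieldAt Z x) :
    dirDeriv (fun y => ⟪Y y, Z y⟫_ℝ) x (S.xi j x)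
      - ⟪mlieBracket 𝓘(ℝ, E) (S.xi j) Y x, Z x⟫_ℝ
      - ⟪Y x, mlieBracket 𝓘(ℝ, E) (S.xi j) Z x⟫_ℝ = 2 * ⟪S.phi x (Y x), S.phi x (Z x)⟫_ℝ := by
  -- Putting `φY` in place of `Y` turns `Φ` into `g(φ·, φ·) = g - ∑ η^i ⊗ η^i`. The `η`-terms then
  -- contribute nothing, since `L_{ξ_j} η^i = 0`.
  have h := hS.lieDeriv_inner_phi j (S.diffFieldAt_phi hY) hZ
  rw [hS.mlieBracket_xi_phi j hY, hS.mlieBracket_xi_phi j hZ, S.inner_phi x,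
    S.inner_phi x (Y x)] at h
  have hd : dirDeriv (fun y => ⟪S.phi y (Y y), S.phi y (Z y)⟫_ℝ) x (S.xi j x) =
      dirDeriv (fun y => ⟪Y y, Z y⟫_ℝ) x (S.xi j x) -
      ∑ i, (S.eta i x (Y x) * dirDeriv (fun y => S.eta i y (Z y)) x (S.xi j x) +
        S.eta i x (Z x) * dirDeriv (fun y => S.eta i y (Y y)) x (S.xi j x)) := by
    have hm : ∀ i ∈ Finset.univ, MDifferentiableAt 𝓘(ℝ, E) 𝓘(ℝ, ℝ)
        (fun y => S.eta i y (Y y) * S.eta i y (Z y)) x := fun i _ =>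
      (S.mdifferentiableAt_eta i hY).mul (S.mdifferentiableAt_eta i hZ)
    simp only [S.inner_phi]
    rw [dirDeriv_sub (MDifferentiableAt.inner_bundle (F := E) (E := TanBundle E M)
      (IB := 𝓘(ℝ, E)) hY hZ) (mdifferentiableAt_finset_sum _ hm), dirDeriv_sum _ hm]
    congr 1
    refine Finset.sum_congr rfl fun i _ => ?_
    rw [dirDeriv_mul (S.mdifferentiableAt_eta i hY) (S.mdifferentiableAt_eta i hZ)]
  rw [hd] at h
  simp only [hS.eta_mlieBracket_xi _ j hY, hS.eta_mlieBracket_xi _ j hZ,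
    Finset.sum_add_distrib] at h
  rw [← h, Finset.sum_congr rfl fun i _ => mul_comm (S.eta i x (Z x)) _]
  ring

end Kenmotsu

end MetricFStructure

/-! ### Invariant submanifolds: the closed forms and the Lie derivative of the metric pass to `M`.
-/

namespace MetricFStructure

open Filter Topology

variable {F : Type*} [NormedAddCommGroup F] [NormedSpace ℝ F] [FiniteDimensional ℝ F] {n s : ℕ}
  {N : Type*} [TopologicalSpace N] [ChartedSpace F N] [IsManifold 𝓘(ℝ, F) ∞ N]
  [RiemannianBundle (TanBundle F N)]
  {S : MetricFStructure F n s N}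
  {E : Type*} [NormedAddCommGroup E] [NormedSpace ℝ E] [FiniteDimensional ℝ E]
  {M : Type*} [TopologicalSpace M] [ChartedSpace E M] [IsManifold 𝓘(ℝ, E) ∞ M]
  [RiemannianBundle (TanBundle E M)] {f : M → N} {x : M}

omit [FiniteDimensional ℝ F] [FiniteDimensional ℝ E] [IsManifold 𝓘(ℝ, E) ∞ M]
  [IsManifold 𝓘(ℝ, F) ∞ N] in
lemma _root_.IsIsometricImmersion.tmap_injective (hf : IsIsometricImmersion (E := E) (F := F) f)
    (x : M) : Function.Injective (tmap (E := E) (F := F) f x) := by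
  refine (injective_iff_map_eq_zero _).2 fun u hu => ?_
  have h := hf.inner_tmap x u u
  rw [hu, inner_zero_left] at h
  exact inner_self_eq_zero.1 h.symm

namespace IsInvariantSubmanifold

omit [FiniteDimensional ℝ F] [FiniteDimensional ℝ E] [IsManifold 𝓘(ℝ, E) ∞ M] in
lemma tmap_xiOn (hf : S.IsInvariantSubmanifold (E := E) f) (i : Fin s) (x : M) :
    tmap f x (S.xiOn f i x : TangentSpace 𝓘(ℝ, E) x) = S.xi i (f x) := by
  have h := hf.xi_tangent i x
  rw [xiOn, restrictField, dif_pos h]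
  exact h.choose_spec

lemma smoothField_xiOn (hf : S.IsInvariantSubmanifold (E := E) f) (i : Fin s) :
    SmoothField (S.xiOn f i : VField E M) :=
  smoothField_restrictField hf.isometric.smooth hf.isometric.tmap_injective (S.smooth_xi i)
    (hf.tmap_xiOn i)

lemma diffFieldAt_xiOn (hf : S.IsInvariantSubmanifold (E := E) f) (i : Fin s) (x : M) :
    DiffFieldAt (S.xiOn f i : VField E M) x :=
  (hf.smoothField_xiOn i).mdifferentiable (by simp) x

-- The pullback of `η^i` is the metric dual of the restricted `ξ_i`, so the computations on `M` need
-- only its metric and these fields.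
omit [FiniteDimensional ℝ F] [FiniteDimensional ℝ E] [IsManifold 𝓘(ℝ, E) ∞ M] in
lemma eta_tmap (hf : S.IsInvariantSubmanifold (E := E) f) (i : Fin s)
    (v : TangentSpace 𝓘(ℝ, E) x) :
    S.eta i (f x) (tmap f x v) = ⟪v, S.xiOn f i x⟫_ℝ := by
  rw [← hf.isometric.inner_tmap, hf.tmap_xiOn, inner_xi]

omit [FiniteDimensional ℝ F] [FiniteDimensional ℝ E] [IsManifold 𝓘(ℝ, E) ∞ M] in
lemma inner_xiOn (hf : S.IsInvariantSubmanifold (E := E) f) (i j : Fin s) (x : M) :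
    ⟪(S.xiOn f i x : TangentSpace 𝓘(ℝ, E) x), S.xiOn f j x⟫_ℝ = if i = j then 1 else 0 := by
  rw [← hf.eta_tmap, hf.tmap_xiOn, S.eta_xi]
  simp [eq_comm]

variable {X Y : VField E M}

/-- The restrictions of the forms `η^i` to an invariant submanifold are closed. -/
lemma inner_xiOn_closed (hf : S.IsInvariantSubmanifold (E := E) f) (hS : S.IsGeneralizedKenmotsu)
    (i : Fin s) (hX : DiffFieldAt X x) (hY : DiffFieldAt Y x) :
    dirDeriv (fun y => ⟪Y y, S.xiOn f i y⟫_ℝ) x (X x)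
      - dirDeriv (E := E) (fun y => ⟪X y, S.xiOn f i y⟫_ℝ) x (Y x)
      - ⟪mlieBracket 𝓘(ℝ, E) X Y x, S.xiOn f i x⟫_ℝ = 0 := by
  have : CompleteSpace E := FiniteDimensional.complete ℝ E
  have : CompleteSpace F := FiniteDimensional.complete ℝ F
  have hinj := hf.isometric.tmap_injective x
  have hfs := hf.isometric.smooth
  have hfd : MDifferentiableAt 𝓘(ℝ, E) 𝓘(ℝ, F) f x := hfs.mdifferentiableAt (by simp)
  -- Closedness is an identity for fields on `N`; it is applied to local extensions and pulled back,
  -- the derivatives by the chain rule and the bracket by relatedness.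
  obtain ⟨X', hX', hXX'⟩ := exists_diffFieldAt_extension hfs hinj hX
  obtain ⟨Y', hY', hYY'⟩ := exists_diffFieldAt_extension hfs hinj hY
  have h := hS.eta_closed i (f x) X' Y' hX' hY'
  have key : ∀ {Z : VField E M} {Z' : VField F N}, DiffFieldAt Z' (f x) →
      (∀ᶠ p in 𝓝 x, tmap f p (Z p) = Z' (f p)) → ∀ v : TangentSpace 𝓘(ℝ, E) x,
      dirDeriv (E := F) (fun y => S.eta i y (Z' y)) (f x) (tmap f x v) =
        dirDeriv (fun y => ⟪Z y, S.xiOn f i y⟫_ℝ) x v := by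
    intro Z Z' hZ' hZZ' v
    rw [← dirDeriv_comp (S.mdifferentiableAt_eta i hZ') hfd]
    refine dirDeriv_congr ?_ v
    filter_upwards [hZZ'] with p hp
    rw [← hp, hf.eta_tmap]
  rw [dEta, ← hXX'.self_of_nhds, ← hYY'.self_of_nhds, key hX' hXX', key hY' hYY',
    ← tmap_mlieBracket_of_related (hfs.contMDiffAt.of_le (by norm_cast)) hX hY hX' hY' hXX' hYY',
    hf.eta_tmap] at h
  exact h

variable [IsContMDiffRiemannianBundle 𝓘(ℝ, F) ∞ F (TanBundle F N)]

/-- The Lie derivative of the induced metric along `ξ_j`. -/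
lemma lieDeriv_inner (hf : S.IsInvariantSubmanifold (E := E) f) (hS : S.IsGeneralizedKenmotsu)
    (j : Fin s) (hX : DiffFieldAt X x) (hY : DiffFieldAt Y x) :
    dirDeriv (E := E) (fun y => ⟪X y, Y y⟫_ℝ) x (S.xiOn f j x)
      - ⟪mlieBracket 𝓘(ℝ, E) (S.xiOn f j) X x, Y x⟫_ℝ
      - ⟪X x, mlieBracket 𝓘(ℝ, E) (S.xiOn f j) Y x⟫_ℝ =
      2 * (⟪X x, Y x⟫_ℝ - ∑ i, ⟪X x, S.xiOn f i x⟫_ℝ * ⟪Y x, S.xiOn f i x⟫_ℝ) := by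
  have : CompleteSpace E := FiniteDimensional.complete ℝ E
  have : CompleteSpace F := FiniteDimensional.complete ℝ F
  have hinj := hf.isometric.tmap_injective x
  have hfs := hf.isometric.smooth
  have hfd : MDifferentiableAt 𝓘(ℝ, E) 𝓘(ℝ, F) f x := hfs.mdifferentiableAt (by simp)
  have hf2 : ContMDiffAt 𝓘(ℝ, E) 𝓘(ℝ, F) 2 f x :=
    hfs.contMDiffAt.of_le (by norm_cast)
  obtain ⟨X', hX', hXX'⟩ := exists_diffFieldAt_extension hfs hinj hX
  obtain ⟨Y', hY', hYY'⟩ := exists_diffFieldAt_extension hfs hinj hY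
  have h := hS.lieDeriv_inner j hX' hY'
  have hξ : ∀ᶠ p in 𝓝 x, tmap f p (S.xiOn f j p : TangentSpace 𝓘(ℝ, E) p) = S.xi j (f p) :=
    Eventually.of_forall fun p => hf.tmap_xiOn j p
  have hd := hf.diffFieldAt_xiOn j x
  have key : dirDeriv (E := F) (fun y => ⟪X' y, Y' y⟫_ℝ) (f x) (tmap (E := E) f x (S.xiOn f j x)) =
        dirDeriv (E := E) (fun y => ⟪X y, Y y⟫_ℝ) x (S.xiOn f j x) := by
    rw [← dirDeriv_comp (MDifferentiableAt.inner_bundle (F := F) (E := TanBundle F N)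
      (IB := 𝓘(ℝ, F)) hX' hY') hfd]
    refine dirDeriv_congr ?_ _
    filter_upwards [hXX', hYY'] with p hp hp'
    rw [← hp, ← hp', hf.isometric.inner_tmap]
  rw [← tmap_mlieBracket_of_related hf2 hd hX (S.diffFieldAt_xi j) hX' hξ hXX',
    ← tmap_mlieBracket_of_related hf2 hd hY (S.diffFieldAt_xi j) hY' hξ hYY',
    ← hf.tmap_xiOn j x, key, ← hXX'.self_of_nhds, ← hYY'.self_of_nhds, S.inner_phi,
    hf.isometric.inner_tmap, hf.isometric.inner_tmap, hf.isometric.inner_tmap] at h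
  simpa only [hf.eta_tmap] using h

end IsInvariantSubmanifold

end MetricFStructure

/-! ### Smooth fields and the action of the bracket on functions. -/

noncomputable section Riemannian

open Filter Topology

variable {E : Type*} [NormedAddCommGroup E] [NormedSpace ℝ E]
  {M : Type*} [TopologicalSpace M] [ChartedSpace E M] [IsManifold 𝓘(ℝ, E) ∞ M] {x : M}

lemma SmoothField.diffFieldAt {X : VField E M} (hX : SmoothField X) (x : M) : DiffFieldAt X x :=
  hX.mdifferentiable (by simp) x

/-- Every tangent vector is the value of a smooth vector field. -/
lemma exists_smoothField_eq [FiniteDimensional ℝ E] [T2Space M] (v : TangentSpace 𝓘(ℝ, E) x) :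
    ∃ X : VField E M, SmoothField X ∧ X x = v := by
  obtain ⟨w, hw, hwv⟩ := FiberBundle.exists_contMDiffOn_extend (k := ∞) 𝓘(ℝ, E) E
    (V := TanBundle E M) v
  obtain ⟨o, how, ho, hxo⟩ := mem_nhds_iff.1 hw
  obtain ⟨b, -, hb⟩ := (SmoothBumpFunction.nhds_basis_tsupport (I := 𝓘(ℝ, E)) x).mem_iff.1
    (ho.mem_nhds hxo)
  refine ⟨_, ContMDiffOn.smul_section_of_tsupport b.contMDiff.contMDiffOn ho hb
    (hwv.mono how), ?_⟩
  simp

lemma ContMDiff.dirDeriv {u : M → ℝ} (hu : ContMDiff 𝓘(ℝ, E) 𝓘(ℝ, ℝ) ∞ u) {X : VField E M}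
    (hX : SmoothField X) :
    ContMDiff 𝓘(ℝ, E) 𝓘(ℝ, ℝ) ∞ (fun y => dirDeriv u y (X y)) := by
  have h1 := hu.contMDiff_tangentMap (m := ∞) (by simp)
  exact (contMDiff_snd_tangentBundle_modelSpace ℝ 𝓘(ℝ, ℝ)).comp (h1.comp hX)

lemma SmoothField.mlieBracket [CompleteSpace E] {X Y : VField E M} (hX : SmoothField X)
    (hY : SmoothField Y) : SmoothField (mlieBracket 𝓘(ℝ, E) X Y) := by
  have : IsManifold 𝓘(ℝ, E) (minSmoothness ℝ 2) M := by
    rw [minSmoothness_of_isRCLikeNormedField]; infer_instance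
  have : IsManifold 𝓘(ℝ, E) (∞ + 1) M := by
    rw [show (∞ : WithTop ℕ∞) + 1 = ∞ from rfl]; infer_instance
  exact ContDiff.mlieBracket_vectorField (m := ⊤) (n := ⊤) hX hY (by simp)

lemma SmoothField.smul {u : M → ℝ} (hu : ContMDiff 𝓘(ℝ, E) 𝓘(ℝ, ℝ) ∞ u) {X : VField E M}
    (hX : SmoothField X) : SmoothField (u • X) :=
  ContMDiff.smul_section hu hX

/-- The Lie bracket acts on functions as the commutator of derivations. -/
theorem dirDeriv_mlieBracket [FiniteDimensional ℝ E] [T2Space M] {u : M → ℝ}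
    (hu : ContMDiff 𝓘(ℝ, E) 𝓘(ℝ, ℝ) ∞ u) {X Y : VField E M} (hX : SmoothField X)
    (hY : SmoothField Y) (x : M) :
    dirDeriv u x (mlieBracket 𝓘(ℝ, E) X Y x) =
      dirDeriv (fun y => dirDeriv u y (Y y)) x (X x)
        - dirDeriv (fun y => dirDeriv u y (X y)) x (Y x) := by
  have : CompleteSpace E := FiniteDimensional.complete ℝ E
  -- The identity is read off from the Jacobi identity for `X`, `Y`, `uZ` as the coefficient of `Z
  -- x`. This needs `Z x ≠ 0`, so the zero tangent space is treated apart.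
  by_cases htriv : ∀ v : TangentSpace 𝓘(ℝ, E) x, v = 0
  · have h0 : ∀ (w : M → ℝ) (v : TangentSpace 𝓘(ℝ, E) x), dirDeriv w x v = 0 := by
      intro w v; rw [htriv v, dirDeriv, map_zero]; rfl
    simp [h0]
  push Not at htriv
  obtain ⟨v, hv⟩ := htriv
  obtain ⟨Z, hZ, hZx⟩ := exists_smoothField_eq v
  have hud : ∀ {w : M → ℝ}, ContMDiff 𝓘(ℝ, E) 𝓘(ℝ, ℝ) ∞ w → ∀ y,
      MDifferentiableAt 𝓘(ℝ, E) 𝓘(ℝ, ℝ) w y := fun hw y => hw.mdifferentiable (by simp) y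
  have smul : ∀ {w : M → ℝ}, ContMDiff 𝓘(ℝ, E) 𝓘(ℝ, ℝ) ∞ w → ∀ {V W : VField E M},
      SmoothField W → ∀ y, mlieBracket 𝓘(ℝ, E) V (w • W) y =
        dirDeriv w y (V y) • W y + w y • mlieBracket 𝓘(ℝ, E) V W y := fun hw V W hW y =>
    mlieBracket_smul_right (hud hw y) (hW.diffFieldAt y)
  have smul2 : ∀ {V W : VField E M}, SmoothField V → SmoothField W →
      mlieBracket 𝓘(ℝ, E) V (mlieBracket 𝓘(ℝ, E) W (u • Z)) x =
        dirDeriv (fun y => dirDeriv u y (W y)) x (V x) • Z x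
        + dirDeriv u x (W x) • mlieBracket 𝓘(ℝ, E) V Z x
        + (dirDeriv u x (V x) • mlieBracket 𝓘(ℝ, E) W Z x
          + u x • mlieBracket 𝓘(ℝ, E) V (mlieBracket 𝓘(ℝ, E) W Z) x) := by
    intro V W hV hW
    have e : mlieBracket 𝓘(ℝ, E) W (u • Z) =
        (fun y => dirDeriv u y (W y)) • Z + u • mlieBracket 𝓘(ℝ, E) W Z := by
      ext y; exact smul hu hZ y
    rw [e, mlieBracket_add_right (((hu.dirDeriv hW)).smul_section hZ |>.mdifferentiable (by simp) x)
      ((hu.smul_section (hW.mlieBracket hZ)).mdifferentiable (by simp) x),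
      smul (hu.dirDeriv hW) hZ, smul hu (hW.mlieBracket hZ)]
  have two : ∀ {W : VField E M}, SmoothField W → ContMDiffAt 𝓘(ℝ, E) 𝓘(ℝ, E).tangent
      (minSmoothness ℝ 2) (fun y => (⟨y, W y⟩ : TangentBundle 𝓘(ℝ, E) M)) x := fun hW =>
    (hW x).of_le (by simp; norm_cast)
  have : IsManifold 𝓘(ℝ, E) (minSmoothness ℝ 3) M := by
    rw [minSmoothness_of_isRCLikeNormedField]; infer_instance
  have j1 := leibniz_identity_mlieBracket_apply (two hX) (two hY) (two (hZ.smul hu))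
  have j2 := leibniz_identity_mlieBracket_apply (two hX) (two hY) (two hZ)
  rw [smul2 hX hY, smul2 hY hX, smul hu hZ, j2] at j1
  -- Subtracting `u` times the Jacobi identity for `X`, `Y`, `Z` cancels everything except a
  -- multiple of `Z x`.
  have : (dirDeriv u x (mlieBracket 𝓘(ℝ, E) X Y x) -
      (dirDeriv (fun y => dirDeriv u y (Y y)) x (X x)
        - dirDeriv (fun y => dirDeriv u y (X y)) x (Y x))) • Z x = 0 := by
    rw [sub_smul, sub_smul, sub_eq_zero]
    simp only [smul_add] at j1
    linear_combination (norm := module) (-1 : ℝ) • j1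
  rw [hZx] at this
  exact sub_eq_zero.1 ((smul_eq_zero.1 this).resolve_right hv)

end Riemannian

/-! ### Levi-Civita connection: the Bianchi identity and skew-symmetry of curvature. -/

namespace IsLeviCivita

open Filter Topology

variable {E : Type*} [NormedAddCommGroup E] [NormedSpace ℝ E] [FiniteDimensional ℝ E]
  {M : Type*} [TopologicalSpace M] [ChartedSpace E M] [IsManifold 𝓘(ℝ, E) ∞ M]
  [RiemannianBundle (TanBundle E M)]
  {nabla : CovariantDerivative 𝓘(ℝ, E) E (TanBundle E M)} {x : M}

omit [FiniteDimensional ℝ E] [RiemannianBundle (TanBundle E M)] in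
lemma _root_.CovariantDerivative.apply_add_field {X Y : VField E M} (hX : DiffFieldAt X x)
    (hY : DiffFieldAt Y x) (v : TangentSpace 𝓘(ℝ, E) x) :
    nabla (fun y => X y + Y y) x v = nabla X x v + nabla Y x v :=
  congr($(nabla.isCovariantDerivativeOnUniv.add hX hY) v)

omit [FiniteDimensional ℝ E] [RiemannianBundle (TanBundle E M)] in
lemma _root_.CovariantDerivative.apply_smul_field {u : M → ℝ} {X : VField E M}
    (hu : MDifferentiableAt 𝓘(ℝ, E) 𝓘(ℝ, ℝ) u x)
    (hX : DiffFieldAt X x) (v : TangentSpace 𝓘(ℝ, E) x) :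
    nabla (fun y => u y • X y) x v = u x • nabla X x v + dirDeriv u x v • X x :=
  congr($(nabla.isCovariantDerivativeOnUniv.leibniz hX hu) v)

omit [FiniteDimensional ℝ E] [RiemannianBundle (TanBundle E M)] in
lemma _root_.CovariantDerivative.apply_sub_field {X Y : VField E M} (hX : DiffFieldAt X x)
    (hY : DiffFieldAt Y x) (v : TangentSpace 𝓘(ℝ, E) x) :
    nabla (fun y => X y - Y y) x v = nabla X x v - nabla Y x v := by
  have hY' : DiffFieldAt (fun y => (-1 : ℝ) • Y y) x :=
    MDifferentiableAt.smul_section mdifferentiableAt_const hY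
  have h := CovariantDerivative.apply_add_field (nabla := nabla) hX hY' v
  rw [CovariantDerivative.apply_smul_field mdifferentiableAt_const hY, dirDeriv_const, zero_smul,
    add_zero] at h
  simpa [sub_eq_add_neg] using h

omit [FiniteDimensional ℝ E] [RiemannianBundle (TanBundle E M)] in
lemma _root_.CovariantDerivative.apply_sum_field {ι : Type*} (s : Finset ι) {X : ι → VField E M}
    (hX : ∀ i ∈ s, DiffFieldAt (X i) x) (v : TangentSpace 𝓘(ℝ, E) x) :
    nabla (fun y => ∑ i ∈ s, X i y) x v = ∑ i ∈ s, nabla (X i) x v := by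
  classical
  induction s using Finset.induction_on with
  | empty =>
    simp only [Finset.sum_empty]
    exact congr($(nabla.zero) x v)
  | insert a s ha ih =>
    simp only [Finset.sum_insert ha]
    rw [CovariantDerivative.apply_add_field (hX a (by simp))
      (MDifferentiableAt.sum_section fun i hi => hX i (by simp [hi])),
      ih fun i hi => hX i (by simp [hi])]

lemma mlieBracket_eq (h : IsLeviCivita nabla) {X Y : VField E M} (hX : DiffFieldAt X x)
    (hY : DiffFieldAt Y x) :
    mlieBracket 𝓘(ℝ, E) X Y x = nabla Y x (X x) - nabla X x (Y x) := by
  have : CompleteSpace E := FiniteDimensional.complete ℝ E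
  exact ((nabla.torsion_eq_zero_iff.1 h.torsion_free) hX hY).symm

lemma smoothField (h : IsLeviCivita nabla) {X Y : VField E M} (hX : SmoothField X)
    (hY : SmoothField Y) : SmoothField (fun y => nabla Y y (X y)) := by
  have h1 := h.smooth.contMDiff.contMDiff (σ := Y) (contMDiffOn_univ.2 hY)
  rw [contMDiffOn_univ] at h1
  exact ContMDiff.clm_bundle_apply (F₁ := E) (F₂ := E) h1 hX

/-- The first Bianchi identity. -/
theorem bianchi (h : IsLeviCivita nabla) {X Y Z : VField E M} (hX : SmoothField X)
    (hY : SmoothField Y) (hZ : SmoothField Z) (x : M) :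
    curvature nabla X Y Z x + curvature nabla Y Z X x + curvature nabla Z X Y x = 0 := by
  have : CompleteSpace E := FiniteDimensional.complete ℝ E
  have : IsManifold 𝓘(ℝ, E) (minSmoothness ℝ 3) M := by
    rw [minSmoothness_of_isRCLikeNormedField]; infer_instance
  have two : ∀ {W : VField E M}, SmoothField W → ContMDiffAt 𝓘(ℝ, E) 𝓘(ℝ, E).tangent
      (minSmoothness ℝ 2) (fun y => (⟨y, W y⟩ : TangentBundle 𝓘(ℝ, E) M)) x := fun hW =>
    (hW x).of_le (by simp; norm_cast)
  -- Vanishing torsion, used twice, gathers the terms into `[A, [B, C]]`; the cyclic sum of these is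
  -- zero by Jacobi.
  have key : ∀ {A B C : VField E M}, SmoothField A → SmoothField B → SmoothField C →
      nabla (fun y => nabla C y (B y)) x (A x) - nabla (fun y => nabla B y (C y)) x (A x)
        - nabla A x (mlieBracket 𝓘(ℝ, E) B C x) =
      mlieBracket 𝓘(ℝ, E) A (mlieBracket 𝓘(ℝ, E) B C) x := by
    intro A B C hA hB hC
    rw [h.mlieBracket_eq (hA.diffFieldAt x) ((hB.mlieBracket hC).diffFieldAt x),
      ← CovariantDerivative.apply_sub_field ((h.smoothField hB hC).diffFieldAt x)
      ((h.smoothField hC hB).diffFieldAt x)]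
    have e : (fun y => nabla C y (B y) - nabla B y (C y)) = mlieBracket 𝓘(ℝ, E) B C := by
      ext y; exact (h.mlieBracket_eq (hB.diffFieldAt y) (hC.diffFieldAt y)).symm
    rw [e]
  have j := leibniz_identity_mlieBracket_apply (two hX) (two hY) (two hZ)
  rw [mlieBracket_swap_apply (V := mlieBracket 𝓘(ℝ, E) X Y)] at j
  have e : mlieBracket 𝓘(ℝ, E) Y (mlieBracket 𝓘(ℝ, E) X Z) x =
      -mlieBracket 𝓘(ℝ, E) Y (mlieBracket 𝓘(ℝ, E) Z X) x := by
    rw [mlieBracket_swap (V := X) (W := Z), ← neg_one_smul ℝ (mlieBracket 𝓘(ℝ, E) Z X),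
      mlieBracket_const_smul_right ((hZ.mlieBracket hX).diffFieldAt x), neg_one_smul]
  rw [e, ← key hX hY hZ, ← key hY hZ hX, ← key hZ hX hY] at j
  simp only [curvature]
  linear_combination (norm := module) (1 : ℝ) • j

omit [FiniteDimensional ℝ E] [RiemannianBundle (TanBundle E M)] in
lemma _root_.curvature_swap (X Y Z : VField E M) (x : M) :
    curvature nabla X Y Z x = -curvature nabla Y X Z x := by
  simp only [curvature]
  rw [mlieBracket_swap_apply, map_neg]
  abel

variable [IsContMDiffRiemannianBundle 𝓘(ℝ, E) ∞ E (TanBundle E M)]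

omit [FiniteDimensional ℝ E] in
lemma _root_.SmoothField.inner {X Y : VField E M} (hX : SmoothField X) (hY : SmoothField Y) :
    ContMDiff 𝓘(ℝ, E) 𝓘(ℝ, ℝ) ∞ (fun y => ⟪X y, Y y⟫_ℝ) :=
  ContMDiff.inner_bundle (F := E) (E := TanBundle E M) (IB := 𝓘(ℝ, E)) hX hY

omit [FiniteDimensional ℝ E] in
lemma _root_.DiffFieldAt.inner {X Y : VField E M} (hX : DiffFieldAt X x) (hY : DiffFieldAt Y x) :
    MDifferentiableAt 𝓘(ℝ, E) 𝓘(ℝ, ℝ) (fun y => ⟪X y, Y y⟫_ℝ) x :=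
  MDifferentiableAt.inner_bundle (F := E) (E := TanBundle E M) (IB := 𝓘(ℝ, E)) hX hY

/-- The curvature endomorphisms of the Levi-Civita connection are skew-symmetric. -/
theorem inner_curvature_skew [T2Space M] (h : IsLeviCivita nabla) {X Y Z W : VField E M}
    (hX : SmoothField X) (hY : SmoothField Y) (hZ : SmoothField Z) (hW : SmoothField W) (x : M) :
    ⟪curvature nabla X Y Z x, W x⟫_ℝ = -⟪curvature nabla X Y W x, Z x⟫_ℝ := by
  -- Second derivatives of `g(Z, W)`. The mixed terms `g(∇Z, ∇W)` are symmetric in `A` and `B`, so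
  -- they disappear from the commutator.
  have key : ∀ {A B : VField E M}, SmoothField A → SmoothField B →
      dirDeriv (fun y => dirDeriv (fun z => ⟪Z z, W z⟫_ℝ) y (B y)) x (A x) =
      ⟪nabla (fun y => nabla Z y (B y)) x (A x), W x⟫_ℝ + ⟪nabla Z x (B x), nabla W x (A x)⟫_ℝ +
      (⟪nabla Z x (A x), nabla W x (B x)⟫_ℝ +
        ⟪Z x, nabla (fun y => nabla W y (B y)) x (A x)⟫_ℝ) := by
    intro A B hA hB
    have e : (fun y => dirDeriv (fun z => ⟪Z z, W z⟫_ℝ) y (B y)) =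
        fun y => ⟪nabla Z y (B y), W y⟫_ℝ + ⟪Z y, nabla W y (B y)⟫_ℝ := by
      ext y; exact h.metric y _ Z W (hZ.diffFieldAt y) (hW.diffFieldAt y)
    have dZ := (h.smoothField hB hZ).diffFieldAt x
    have dW := (h.smoothField hB hW).diffFieldAt x
    rw [e, dirDeriv_add (dZ.inner (hW.diffFieldAt x)) ((hZ.diffFieldAt x).inner dW),
      h.metric x _ _ W dZ (hW.diffFieldAt x), h.metric x _ Z _ (hZ.diffFieldAt x) dW]
  have c := dirDeriv_mlieBracket (hZ.inner hW) hX hY x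
  rw [key hX hY, key hY hX, h.metric x _ Z W (hZ.diffFieldAt x) (hW.diffFieldAt x)] at c
  simp only [curvature, inner_sub_left]
  simp only [real_inner_comm _ (Z x)] at c
  linarith

/-! ### Curvature when `∇ξ_i` is the projection `P` for every `i`. -/

variable {ι : Type*} [Fintype ι] {ξ : ι → VField E M}

/-- The component of a tangent vector orthogonal to an orthonormal family of vector fields. -/
noncomputable def _root_.orthComponent (ξ : ι → VField E M) (x : M) (v : TangentSpace 𝓘(ℝ, E) x) :
    TangentSpace 𝓘(ℝ, E) x :=
  v - ∑ l, ⟪v, ξ l x⟫_ℝ • ξ l x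

omit [FiniteDimensional ℝ E] [IsManifold 𝓘(ℝ, E) ∞ M]
  [IsContMDiffRiemannianBundle 𝓘(ℝ, E) ∞ E (TanBundle E M)] in
lemma _root_.inner_orthComponent (v w : TangentSpace 𝓘(ℝ, E) x) :
    ⟪orthComponent ξ x v, w⟫_ℝ = ⟪v, w⟫_ℝ - ∑ l, ⟪v, ξ l x⟫_ℝ * ⟪w, ξ l x⟫_ℝ := by
  simp [orthComponent, inner_sub_left, sum_inner, inner_smul_left, real_inner_comm]

omit [FiniteDimensional ℝ E] [IsManifold 𝓘(ℝ, E) ∞ M]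
  [IsContMDiffRiemannianBundle 𝓘(ℝ, E) ∞ E (TanBundle E M)] in
lemma _root_.inner_orthComponent_comm (v w : TangentSpace 𝓘(ℝ, E) x) :
    ⟪orthComponent ξ x v, w⟫_ℝ = ⟪orthComponent ξ x w, v⟫_ℝ := by
  rw [inner_orthComponent, inner_orthComponent, real_inner_comm]
  simp only [mul_comm]

omit [IsContMDiffRiemannianBundle 𝓘(ℝ, E) ∞ E (TanBundle E M)] in
/-- The connection is determined on a vector field with closed dual form by the Lie derivative
of the metric along the field. -/
theorem apply_eq_orthComponent (h : IsLeviCivita nabla) {V : VField E M} (hV : SmoothField V)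
    (hclosed : ∀ X Y : VField E M, DiffFieldAt X x → DiffFieldAt Y x →
      dirDeriv (fun y => ⟪Y y, V y⟫_ℝ) x (X x) - dirDeriv (fun y => ⟪X y, V y⟫_ℝ) x (Y x)
        - ⟪mlieBracket 𝓘(ℝ, E) X Y x, V x⟫_ℝ = 0)
    (hlie : ∀ X Y : VField E M, DiffFieldAt X x → DiffFieldAt Y x →
      dirDeriv (fun y => ⟪X y, Y y⟫_ℝ) x (V x) - ⟪mlieBracket 𝓘(ℝ, E) V X x, Y x⟫_ℝ
        - ⟪X x, mlieBracket 𝓘(ℝ, E) V Y x⟫_ℝ =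
        2 * (⟪X x, Y x⟫_ℝ - ∑ l, ⟪X x, ξ l x⟫_ℝ * ⟪Y x, ξ l x⟫_ℝ))
    (v : TangentSpace 𝓘(ℝ, E) x) : nabla V x v = orthComponent ξ x v := by
  refine ext_inner_right ℝ fun w => ?_
  obtain ⟨X, hX, rfl⟩ : ∃ X : VField E M, DiffFieldAt X x ∧ X x = v :=
    ⟨FiberBundle.extend E v, FiberBundle.mdifferentiableAt_extend 𝓘(ℝ, E) E v, by simp⟩
  obtain ⟨Y, hY, rfl⟩ : ∃ Y : VField E M, DiffFieldAt Y x ∧ Y x = w :=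
    ⟨FiberBundle.extend E w, FiberBundle.mdifferentiableAt_extend 𝓘(ℝ, E) E w, by simp⟩
  have hVx := hV.diffFieldAt x
  -- After torsion-freeness, `h1` says `g(∇_X V, Y) = g(X, ∇_Y V)` and `h2` says that these two
  -- numbers add up to `2 g(PX, Y)`.
  have h1 := hclosed X Y hX hY
  have h2 := hlie X Y hX hY
  rw [h.metric x _ Y V hY hVx, h.metric x _ X V hX hVx, h.mlieBracket_eq hX hY] at h1
  rw [h.metric x _ X Y hX hY, h.mlieBracket_eq hVx hX, h.mlieBracket_eq hVx hY] at h2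
  simp only [inner_sub_left, inner_sub_right] at h1 h2
  rw [inner_orthComponent]
  have c1 := real_inner_comm (nabla V x (X x)) (Y x)
  linarith

section Curvature

variable (hξ : ∀ i, SmoothField (ξ i))
  (hnξ : ∀ i x v, nabla (ξ i) x v = orthComponent ξ x v)

include hξ hnξ

/-- Second covariant derivative of `ξ i`. -/
lemma apply_apply (h : IsLeviCivita nabla) {Y : VField E M} (hY : DiffFieldAt Y x) (i : ι)
    (v : TangentSpace 𝓘(ℝ, E) x) :
    nabla (fun y => nabla (ξ i) y (Y y)) x v =
      orthComponent ξ x (nabla Y x v) - ∑ l, ⟪Y x, ξ l x⟫_ℝ • orthComponent ξ x v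
        - ⟪orthComponent ξ x v, Y x⟫_ℝ • ∑ l, ξ l x := by
  have hu : ∀ l, MDifferentiableAt 𝓘(ℝ, E) 𝓘(ℝ, ℝ) (fun y => ⟪Y y, ξ l y⟫_ℝ) x := fun l =>
    hY.inner ((hξ l).diffFieldAt x)
  have hs : ∀ l ∈ Finset.univ, DiffFieldAt (fun y => ⟪Y y, ξ l y⟫_ℝ • ξ l y) x := fun l _ =>
    (hu l).smul_section ((hξ l).diffFieldAt x)
  -- The term `g(Y, ∇_v ξ_l) = g(Y, Pv)` does not depend on `l`; this is the source of the factor `∑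
  -- l, ξ l x`.
  have hd : ∀ l, dirDeriv (fun y => ⟪Y y, ξ l y⟫_ℝ) x v =
      ⟪nabla Y x v, ξ l x⟫_ℝ + ⟪orthComponent ξ x v, Y x⟫_ℝ := fun l => by
    rw [h.metric x v Y (ξ l) hY ((hξ l).diffFieldAt x), hnξ, real_inner_comm _ (Y x)]
  simp only [hnξ]
  have := CovariantDerivative.apply_sub_field (nabla := nabla) hY
    (MDifferentiableAt.sum_section hs) v
  rw [CovariantDerivative.apply_sum_field _ hs] at this
  simp only [CovariantDerivative.apply_smul_field (hu _) ((hξ _).diffFieldAt x), hnξ, hd,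
    Finset.sum_add_distrib, add_smul, ← Finset.smul_sum] at this
  refine this.trans ?_
  rw [orthComponent.eq_1 ξ x (nabla Y x v), Finset.smul_sum]
  abel

/-- On antisymmetrizing `apply_apply`, the terms `P(∇Y)` and `P(∇X)` cancel against `∇_{[X, Y]} ξ_i
= P[X, Y]`, and the multiples of `∑ ξ_l` cancel because `P` is self-adjoint. -/
theorem curvature_apply (h : IsLeviCivita nabla) {X Y : VField E M} (hX : DiffFieldAt X x)
    (hY : DiffFieldAt Y x) (i : ι) :
    curvature nabla X Y (ξ i) x =
      ∑ l, (⟪X x, ξ l x⟫_ℝ • orthComponent ξ x (Y x)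
        - ⟪Y x, ξ l x⟫_ℝ • orthComponent ξ x (X x)) := by
  rw [curvature, h.apply_apply hξ hnξ hY, h.apply_apply hξ hnξ hX, hnξ, h.mlieBracket_eq hX hY,
    inner_orthComponent_comm (X x) (Y x), Finset.sum_sub_distrib]
  have : orthComponent ξ x (nabla Y x (X x) - nabla X x (Y x)) =
      orthComponent ξ x (nabla Y x (X x)) - orthComponent ξ x (nabla X x (Y x)) := by
    simp only [orthComponent, inner_sub_left, sub_smul, Finset.sum_sub_distrib]
    abel
  rw [this]
  abel

/-- Let `T(A, B, C) = g(R(ξ_j, A)B, C)`. Bianchi and the known `R(A, B)ξ_j` give `T(A, B, C) - T(B,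
A, C)`, while `T` is skew in its last two arguments. As in the Koszul formula, these two facts
determine `T`. -/
theorem curvature_apply_left [T2Space M] (h : IsLeviCivita nabla) {X Y : VField E M}
    (hX : SmoothField X) (hY : SmoothField Y) (j : ι) (x : M) :
    curvature nabla (ξ j) X Y x =
      ∑ l, (⟪Y x, ξ l x⟫_ℝ • orthComponent ξ x (X x)
        - ⟪orthComponent ξ x (Y x), X x⟫_ℝ • ξ l x) := by
  refine ext_inner_right ℝ fun w => ?_
  obtain ⟨Z, hZ, rfl⟩ := exists_smoothField_eq w
  have b : ∀ {A B C : VField E M}, SmoothField A → SmoothField B → SmoothField C →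
      ⟪curvature nabla (ξ j) A B x, C x⟫_ℝ - ⟪curvature nabla (ξ j) B A x, C x⟫_ℝ =
      (∑ l, ⟪B x, ξ l x⟫_ℝ) * ⟪orthComponent ξ x (A x), C x⟫_ℝ -
      (∑ l, ⟪A x, ξ l x⟫_ℝ) * ⟪orthComponent ξ x (B x), C x⟫_ℝ := by
    intro A B C hA hB hC
    have h1 := h.bianchi (hξ j) hA hB x
    rw [h.curvature_apply hξ hnξ (hA.diffFieldAt x) (hB.diffFieldAt x), curvature_swap B] at h1
    have h2 := congr_arg (fun v => ⟪v, C x⟫_ℝ) h1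
    simp only [inner_add_left, inner_neg_left, sum_inner, inner_sub_left, real_inner_smul_left,
      inner_zero_left, Finset.sum_sub_distrib, ← Finset.sum_mul] at h2
    linarith
  -- Three skew-symmetries and three instances of `b` form a linear system whose solution is `T(X,
  -- Y, Z)`.
  have s1 := h.inner_curvature_skew (hξ j) hX hY hZ x
  have s2 := h.inner_curvature_skew (hξ j) hY hX hZ x
  have s3 := h.inner_curvature_skew (hξ j) hZ hX hY x
  have b1 := b hX hY hZ
  have b2 := b hY hZ hX
  have b3 := b hX hZ hY
  simp only [sum_inner, inner_sub_left, real_inner_smul_left, Finset.sum_sub_distrib,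
    ← Finset.sum_mul, ← Finset.mul_sum]
  simp only [fun l => real_inner_comm (Z x) (ξ l x)]
  simp only [inner_orthComponent_comm (X x) (Y x), inner_orthComponent_comm (X x) (Z x),
    inner_orthComponent_comm (Y x) (Z x)] at b1 b2 b3 ⊢
  linarith

end Curvature

end IsLeviCivita

/-! ### The curvature formulas on an invariant submanifold. -/

theorem mainTheorem6
    {F : Type*} [NormedAddCommGroup F] [NormedSpace ℝ F] [FiniteDimensional ℝ F] {n s : ℕ}
    {N : Type*} [TopologicalSpace N] [T2Space N] [ChartedSpace F N] [IsManifold 𝓘(ℝ, F) ∞ N]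
    [RiemannianBundle (TanBundle F N)]
    [IsContMDiffRiemannianBundle 𝓘(ℝ, F) ∞ F (TanBundle F N)]
    (S : MetricFStructure F n s N) (hS : S.IsGeneralizedKenmotsu)
    {E : Type*} [NormedAddCommGroup E] [NormedSpace ℝ E] [FiniteDimensional ℝ E]
    {M : Type*} [TopologicalSpace M] [T2Space M] [ChartedSpace E M] [IsManifold 𝓘(ℝ, E) ∞ M]
    [RiemannianBundle (TanBundle E M)]
    [IsContMDiffRiemannianBundle 𝓘(ℝ, E) ∞ E (TanBundle E M)]
    (f : M → N) (hf : S.IsInvariantSubmanifold (E := E) f)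
    (nabla : CovariantDerivative 𝓘(ℝ, E) E (TanBundle E M)) (hnabla : IsLeviCivita nabla) :
    (∀ X Y : VField E M, SmoothField X → SmoothField Y → ∀ (i : Fin s) (x : M),
      tmap f x (curvature nabla X Y (S.xiOn f i) x) =
        ∑ j, (S.eta j (f x) (tmap f x (Y x)) • S.phi (f x) (S.phi (f x) (tmap f x (X x)))
          - S.eta j (f x) (tmap f x (X x)) • S.phi (f x) (S.phi (f x) (tmap f x (Y x))))) ∧
    (∀ X : VField E M, SmoothField X → ∀ (i j : Fin s) (x : M),
      tmap f x (curvature nabla (S.xiOn f j) X (S.xiOn f i) x) =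
        -S.phi (f x) (S.phi (f x) (tmap f x (X x)))) ∧
    (∀ X : VField E M, SmoothField X → ∀ (i j : Fin s) (x : M),
      tmap f x (curvature nabla X (S.xiOn f j) (S.xiOn f i) x) =
        S.phi (f x) (S.phi (f x) (tmap f x (X x)))) ∧
    (∀ (i j k : Fin s) (x : M),
      curvature nabla (S.xiOn f k) (S.xiOn f j) (S.xiOn f i) x = 0) ∧
    (∀ X Y : VField E M, SmoothField X → SmoothField Y → ∀ (j : Fin s) (x : M),
      tmap f x (curvature nabla (S.xiOn f j) X Y x) =
        ∑ k, (⟪(tmap f x (X x) : TangentSpace 𝓘(ℝ, F) (f x)),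
              S.phi (f x) (S.phi (f x) (tmap f x (Y x)))⟫_ℝ • S.xi k (f x)
          - S.eta k (f x) (tmap f x (Y x)) • S.phi (f x) (S.phi (f x) (tmap f x (X x))))) := by
  have hξ : ∀ i, SmoothField (S.xiOn f i : VField E M) := hf.smoothField_xiOn
  have hnξ : ∀ i x v, nabla (S.xiOn f i) x v = orthComponent (S.xiOn f) x v := fun i x v =>
    hnabla.apply_eq_orthComponent (hξ i) (fun X Y hX hY => hf.inner_xiOn_closed hS i hX hY)
      (fun X Y hX hY => hf.lieDeriv_inner hS i hX hY) v
  -- The bridge from the intrinsic formulas in `P` to the stated ones in `φ²`; it accounts for the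
  -- change of sign.
  have htP : ∀ (x : M) (v : TangentSpace 𝓘(ℝ, E) x), tmap f x (orthComponent (S.xiOn f) x v) =
      -S.phi (f x) (S.phi (f x) (tmap f x v)) := by
    intro x v
    rw [S.phi_sq, orthComponent, map_sub, map_sum]
    simp only [map_smul, hf.tmap_xiOn, hf.eta_tmap]
    abel
  have hPξ : ∀ j (x : M),
      orthComponent (S.xiOn f) x (S.xiOn f j x : TangentSpace 𝓘(ℝ, E) x) = 0 := by
    intro j x
    simp [orthComponent, hf.inner_xiOn]
  have h1 : ∀ X Y : VField E M, SmoothField X → SmoothField Y → ∀ (i : Fin s) (x : M),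
      curvature nabla X Y (S.xiOn f i) x =
        ∑ l, (⟪X x, S.xiOn f l x⟫_ℝ • orthComponent (S.xiOn f) x (Y x)
          - ⟪Y x, S.xiOn f l x⟫_ℝ • orthComponent (S.xiOn f) x (X x)) :=
    fun X Y hX hY i x => hnabla.curvature_apply hξ hnξ (hX.diffFieldAt x) (hY.diffFieldAt x) i
  have h2 : ∀ X : VField E M, SmoothField X → ∀ (i j : Fin s) (x : M),
      curvature nabla (S.xiOn f j) X (S.xiOn f i) x = orthComponent (S.xiOn f) x (X x) := by
    intro X hX i j x
    rw [h1 _ X (hξ j) hX]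
    simp [hPξ, hf.inner_xiOn]
  refine ⟨fun X Y hX hY i x => ?_, fun X hX i j x => ?_, fun X hX i j x => ?_, fun i j k x => ?_,
    fun X Y hX hY j x => ?_⟩
  · rw [h1 X Y hX hY, map_sum]
    refine Finset.sum_congr rfl fun l _ => ?_
    rw [map_sub, map_smul, map_smul, htP, htP, hf.eta_tmap, hf.eta_tmap]
    module
  · rw [h2 X hX, htP]
  · rw [curvature_swap, h2 X hX, map_neg, htP, neg_neg]
  · rw [h2 _ (hξ j), hPξ]
  · rw [hnabla.curvature_apply_left hξ hnξ hX hY, map_sum]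
    refine Finset.sum_congr rfl fun l _ => ?_
    -- The coefficient `g(PY, X)` is an inner product on `M`; the isometry moves it to `N`, where it
    -- becomes `-g(X, φ²Y)`.
    rw [map_sub, map_smul, map_smul, htP, hf.eta_tmap, hf.tmap_xiOn,
      ← hf.isometric.inner_tmap x _ (X x), htP, inner_neg_left, real_inner_comm (tmap f x (X x))]
    module
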